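/- **Proposition (Approximated Gaussian Mixture Fisher–Rao Parameter Flow).** Let $p(x)>0$ be a prior density on $\mathbb{R}^n$, let $p(z\mid x)>0$ be a likelihood at a fixed measurement $z$, let the joint density $x\mapsto p(x,z)=p(z\mid x)p(x)$ be $C^2$ and integrable, and let $p(x\mid z)=p(x,z)/\int p(x',z)\,dx'$ be the posterior density. For $K\ge 1$ consider the Gaussian mixtures $$q(x;\eta)=\sum_{k=1}^K q(x\mid\omega=k;\eta)\,q(\omega=k;\eta),\qquad q(x\mid\omega=k;\eta)=p_{\mathcal N}(x;\mu^{(k)},\Sigma^{(k)}),\quad q(\omega=k;\eta)=\pi^{(k)}>0,\ \ \sum_{k}\pi^{(k)}=1,$$ with $\Sigma^{(k)}\succ0$, in the natural parameters $\eta$ consisting of $$\gamma^{(k)}=[\Sigma^{(k)}]^{-1}\mu^{(k)},\qquad \Gamma^{(k)}=-\tfrac12[\Sigma^{(k)}]^{-1}\ \text{(symmetric)},\qquad \eta_\omega^{(k)}=\log\frac{\pi^{(k)}}{\pi^{(K)}},$$ where $\eta_\omega^{(K)}\equiv0$, so that the free log-odds are $\eta_\omega=(\eta_\omega^{(1)},\dots,\eta_\omega^{(K-1)})$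 and $\pi^{(k)}=e^{\eta^{(k)}_\omega}/\sum_{j=1}^K e^{\eta_\omega^{(j)}}$; a symmetric matrix is parametrized by its entries on and above the diagonal. The Fisher information matrix (FIM) of a parametric density is $\mathcal I(\theta)=\mathbb E_{p(\cdot;\theta)}[\nabla_\theta\log p\,\nabla_\theta^\top\log p]$. Let the approximated FIM $\tilde{\mathcal I}(\eta)$ of the mixture be the FIM of the joint density $q(x,\omega;\eta)=q(x\mid\omega;\eta)q(\omega;\eta)$ of state and component label, and let $$V(x;\eta)=\log q(x;\eta)-\log p(x,z),\qquad D_{KL}(q\,\|\,p)=\int q(x)\log\frac{q(x)}{p(x)}\,dx .$$ Let $\Theta$ be an open set of such parameters $\eta$ such that, for all $\eta\in\Theta$ and all $k$, the functions $\log p(x,z)$, $\nabla_x\log p(x,z)$, $\nabla_x^2\log p(x,z)$ have finite expectations under $q(x\mid\omega=k;\eta)$. Then: 1. For $\eta\in\Theta$, the entries of $\tilde{\mathcal I}(\eta)$ are absolutely convergent integrals and $\tilde{\mathcal I}(\eta)$ is positive definite; the integral defining $D_{KL}(q(\cdot;\eta)\,\|\,p(\cdot\mid z))$ converges absolutely and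 is differentiable in $\eta$ on $\Theta$; $V(\cdot;\eta)$ is $C^2$, and $V,\nabla_xV,\nabla_x^2V$ have finite expectations under every component. 2. For $\eta\in\Theta$, $\tilde{\mathcal I}(\eta)$ is block diagonal: $$\tilde{\mathcal I}(\eta)=\operatorname{diag}\big(\pi^{(1)}\mathcal I(\gamma^{(1)},\Gamma^{(1)}),\dots,\pi^{(K)}\mathcal I(\gamma^{(K)},\Gamma^{(K)}),\ \mathcal I(\eta_\omega)\big),$$ where $\mathcal I(\gamma^{(k)},\Gamma^{(k)})$ is the FIM of the Gaussian $q(x\mid\omega=k)$ and $\mathcal I(\eta_\omega)$ is the FIM of the multinomial distribution $q(\omega)$ in its log-odds. 3. Let $t\mapsto\eta_t$ be a curve of parameters on a set of times and let $t$ be a time with $\eta_t\in\Theta$. Then the natural-gradient flow equation $$\frac{d\eta_t}{dt}=-\tilde{\mathcal I}^{-1}(\eta_t)\,\nabla_{\eta_t}D_{KL}\big(q(x;\eta_t)\,\|\,p(x\mid z)\big)$$ holds at $t$ if and only if, for every $k=1,\dots,K$, $$\begin{aligned} \frac{d\gamma^{(k)}_t}{dt}&=-\mathbb E_{q(x\mid\omega=k;\eta_t)}\Big[\tfrac12\nabla_x^2V(x;\eta_t)\,[\Gamma^{(k)}_t]^{-1}\gamma^{(k)}_t+\nabla_xV(x;\eta_t)\Big],\\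 \frac{d\Gamma^{(k)}_t}{dt}&=-\tfrac12\,\mathbb E_{q(x\mid\omega=k;\eta_t)}\big[\nabla_x^2V(x;\eta_t)\big],\\ \frac{d[\eta^{(k)}_\omega]_t}{dt}&=\mathbb E_{q(x\mid\omega=K;\eta_t)}[V(x;\eta_t)]-\mathbb E_{q(x\mid\omega=k;\eta_t)}[V(x;\eta_t)]. \end{aligned}$$ -/

import Mathlib

open MeasureTheory
open scoped Matrix

noncomputable section

namespace GMFlow

/-- The state space `ℝⁿ` with its Euclidean norm. -/
abbrev Vec (n : ℕ) : Type := EuclideanSpace ℝ (Fin n)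

/-! ### Fisher information -/

/-- The Fisher information matrix at `θ` of a parametric family of densities `p θ` with respect
to a base measure `ν`: the `(a, b)` entry is `E_{p θ} [∂_a log (p θ) · ∂_b log (p θ)]`. -/
def fisherInfo {Ω ι : Type*} [MeasurableSpace Ω] [Fintype ι] [DecidableEq ι]
    (ν : Measure Ω) (p : (ι → ℝ) → Ω → ℝ) (θ : ι → ℝ) : Matrix ι ι ℝ :=
  Matrix.of fun a b => ∫ y, p θ y *
    (fderiv ℝ (fun θ' => Real.log (p θ' y)) θ (Pi.single a 1) *
      fderiv ℝ (fun θ' => Real.log (p θ' y)) θ (Pi.single b 1)) ∂ν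

/-! ### A Gaussian in natural parameters -/

/-- The density of the Gaussian with mean `μ` and covariance `S`. -/
def gaussPDF {n : ℕ} (μ : Fin n → ℝ) (S : Matrix (Fin n) (Fin n) ℝ) (x : Vec n) : ℝ :=
  (Real.sqrt ((2 * Real.pi) ^ n * S.det))⁻¹ *
    Real.exp (-(1 / 2) * ((fun i => x i - μ i) ⬝ᵥ (S⁻¹ *ᵥ fun i => x i - μ i)))

/-- Coordinates for the natural parameters `(γ, Γ)` of one Gaussian: the entries of `γ` and the
entries on and above the diagonal of the symmetric matrix `Γ`. -/
abbrev GIndex (n : ℕ) : Type := Fin n ⊕ {p : Fin n × Fin n // p.1 ≤ p.2}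

abbrev GParam (n : ℕ) : Type := GIndex n → ℝ

/-- The natural parameter `γ = Σ⁻¹ μ`. -/
def GParam.gam {n : ℕ} (θ : GParam n) : Fin n → ℝ := fun i => θ (Sum.inl i)

/-- The natural parameter `Γ = -½ Σ⁻¹`, a symmetric matrix. -/
def GParam.Gam {n : ℕ} (θ : GParam n) : Matrix (Fin n) (Fin n) ℝ :=
  Matrix.of fun i j => θ (Sum.inr ⟨(min i j, max i j), min_le_max⟩)

/-- The covariance `Σ = (-2 Γ)⁻¹`. -/
def GParam.cov {n : ℕ} (θ : GParam n) : Matrix (Fin n) (Fin n) ℝ := ((-2 : ℝ) • θ.Gam)⁻¹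

/-- The mean `μ = Σ γ`. -/
def GParam.mean {n : ℕ} (θ : GParam n) : Fin n → ℝ := θ.cov *ᵥ θ.gam

/-- The Gaussian density as a function of its natural parameters. -/
def natGauss {n : ℕ} (θ : GParam n) (x : Vec n) : ℝ := gaussPDF θ.mean θ.cov x

/-! ### Component weights in log-odds

There are `K = m + 1` components, indexed by `Fin (m + 1)`; the last one is the reference
component, whose log-odds are identically zero. -/

/-- All `m + 1` log-odds `log (π_k / π_K)`, from the `m` free ones. -/
def logOdds {m : ℕ} (w : Fin m → ℝ) (k : Fin (m + 1)) : ℝ :=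
  Fin.lastCases (motive := fun _ => ℝ) 0 w k

/-- The weight `π_k = q(ω = k)`. -/
def weight {m : ℕ} (w : Fin m → ℝ) (k : Fin (m + 1)) : ℝ :=
  Real.exp (logOdds w k) / ∑ j, Real.exp (logOdds w j)

/-! ### The Gaussian mixture -/

/-- Coordinates for the natural parameters of a mixture of `m + 1` Gaussians on `ℝⁿ`. -/
abbrev MIndex (n m : ℕ) : Type := (GIndex n × Fin (m + 1)) ⊕ Fin m

abbrev MParam (n m : ℕ) : Type := MIndex n m → ℝ

/-- The natural parameters `(γ, Γ)` of the `k`th component. -/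
def MParam.comp {n m : ℕ} (η : MParam n m) (k : Fin (m + 1)) : GParam n :=
  fun a => η (Sum.inl (a, k))

/-- The free log-odds. -/
def MParam.odds {n m : ℕ} (η : MParam n m) : Fin m → ℝ := fun k => η (Sum.inr k)

/-- The parameters for which every covariance is (well defined and) positive definite. -/
def admissible (n m : ℕ) : Set (MParam n m) := {η | ∀ k, (-(η.comp k).Gam).PosDef}

/-- The joint density `q(x, ω; η) = q(x | ω; η) q(ω; η)` of the state and the component label,
with respect to Lebesgue measure times counting measure. -/
def jointQ {n m : ℕ} (η : MParam n m) (y : Vec n × Fin (m + 1)) : ℝ :=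
  natGauss (η.comp y.2) y.1 * weight η.odds y.2

/-- The mixture density `q(x; η) = ∑ₖ q(x | ω = k) q(ω = k)`. -/
def mixture {n m : ℕ} (η : MParam n m) (x : Vec n) : ℝ := ∑ k, jointQ η (x, k)

/-- The approximated Fisher information matrix of the mixture: the Fisher information matrix of
the joint density `q(x, ω; η)` in the natural parameters. -/
def approxFIM {n m : ℕ} (η : MParam n m) : Matrix (MIndex n m) (MIndex n m) ℝ :=
  fisherInfo ((volume : Measure (Vec n)).prod Measure.count) jointQ η

/-- `E_{q(x | ω = k; η)} [f]`. -/
def compE {n m : ℕ} (η : MParam n m) (k : Fin (m + 1)) (f : Vec n → ℝ) : ℝ :=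
  ∫ x, natGauss (η.comp k) x * f x

/-- `f` has a finite expectation under `q(x | ω = k; η)`. -/
def CompIntegrable {n m : ℕ} (η : MParam n m) (k : Fin (m + 1)) (f : Vec n → ℝ) : Prop :=
  Integrable (fun x => natGauss (η.comp k) x * f x) volume

/-- The Hessian matrix, i.e. the Jacobian of the gradient. -/
def hessian {n : ℕ} (f : Vec n → ℝ) (x : Vec n) : Matrix (Fin n) (Fin n) ℝ :=
  Matrix.of fun i j => (fderiv ℝ (gradient f) x (EuclideanSpace.single j 1)) i

/-! ### The Bayesian model and the flow -/

/-- The joint density `p(x, z) = p(z | x) p(x)`, as a function of `x`. -/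
def jointP {n d : ℕ} (prior : Vec n → ℝ) (lik : Vec d → Vec n → ℝ) (z : Vec d) (x : Vec n) : ℝ :=
  lik z x * prior x

/-- The posterior density `p(x | z) = p(z | x) p(x) / ∫ p(z | x') p(x') dx'`. -/
def posterior {n d : ℕ} (prior : Vec n → ℝ) (lik : Vec d → Vec n → ℝ) (z : Vec d)
    (x : Vec n) : ℝ :=
  jointP prior lik z x / ∫ x', jointP prior lik z x'

/-- The integrand of the Kullback-Leibler divergence. -/
def klIntegrand {n : ℕ} (q p : Vec n → ℝ) (x : Vec n) : ℝ := q x * Real.log (q x / p x)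

/-- The Kullback-Leibler divergence of two densities. -/
def kl {n : ℕ} (q p : Vec n → ℝ) : ℝ := ∫ x, klIntegrand q p x

/-- The objective `η ↦ D_KL (q(·; η) ‖ p(· | z))`. -/
def objective {n m d : ℕ} (prior : Vec n → ℝ) (lik : Vec d → Vec n → ℝ) (z : Vec d)
    (η : MParam n m) : ℝ :=
  kl (mixture η) (posterior prior lik z)

/-- The vector of partial derivatives of a function of the parameters. -/
def partials {ι : Type*} [Fintype ι] [DecidableEq ι] (F : (ι → ℝ) → ℝ) (θ : ι → ℝ) : ι → ℝ :=
  fun a => fderiv ℝ F θ (Pi.single a 1)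

/-- The velocity field `-Ĩ(η)⁻¹ ∇_η D_KL (q(·; η) ‖ p(· | z))` of the approximated Gaussian
mixture Fisher-Rao parameter flow. -/
def flowField {n m d : ℕ} (prior : Vec n → ℝ) (lik : Vec d → Vec n → ℝ) (z : Vec d)
    (η : MParam n m) : MParam n m :=
  -((approxFIM η)⁻¹ *ᵥ partials (objective prior lik z) η)

/-- `V(x; η) = log q(x; η) - log p(x, z)`. -/
def kernelV {n m d : ℕ} (prior : Vec n → ℝ) (lik : Vec d → Vec n → ℝ) (z : Vec d)
    (η : MParam n m) (x : Vec n) : ℝ :=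
  Real.log (mixture η x) - Real.log (jointP prior lik z x)

/-- The component-wise equations at time `t` for a curve of parameters on the time set `I`:
`γ̇ = -E[½ ∇²V Γ⁻¹ γ + ∇V]` and `Γ̇ = -½ E[∇²V]` under the `k`th component, and
`η̇_ω = E_K[V] - E_k[V]`. -/
def ComponentODE {n m d : ℕ} (prior : Vec n → ℝ) (lik : Vec d → Vec n → ℝ) (z : Vec d)
    (c : ℝ → MParam n m) (I : Set ℝ) (t : ℝ) (k : Fin (m + 1)) : Prop :=
  (∀ i, HasDerivWithinAt (fun s => ((c s).comp k).gam i)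
    (-compE (c t) k (fun x =>
      ((1 / 2 : ℝ) • (hessian (kernelV prior lik z (c t)) x *ᵥ
        ((((c t).comp k).Gam)⁻¹ *ᵥ ((c t).comp k).gam))) i
      + gradient (kernelV prior lik z (c t)) x i)) I t) ∧
  (∀ i j, HasDerivWithinAt (fun s => ((c s).comp k).Gam i j)
    (-(1 / 2 : ℝ) * compE (c t) k (fun x => hessian (kernelV prior lik z (c t)) x i j)) I t) ∧
  HasDerivWithinAt (fun s => logOdds (c s).odds k)
    (compE (c t) (Fin.last m) (kernelV prior lik z (c t))
      - compE (c t) k (kernelV prior lik z (c t))) I t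

end GMFlow

end

open MeasureTheory
open scoped Matrix

noncomputable section

namespace GMFlow

/-! ### Functions growing slower than every Gaussian -/

/-! The logarithm of the joint density of state and label has, in direction `v` and for label `k`,
the score `jscore η x k v`: a polynomial of degree at most two in `x` (`suff` applied to the `k`th
part of `v`, minus the derivative of the log-partition function) plus the score of the weights,
which is constant in `x`. Hence the approximated Fisher matrix is the bilinear form `∑ₖ πₖ Eₖ[s(u)
s(v)]`, where `s` is this score. Differentiating the divergence under the integral gives `∑ₖ πₖ
Eₖ[s(v) V]`, because scores have mean zero and so every additive constant, including the log of the
evidence, drops out. The flow velocity is therefore the unique `u` with `∑ₖ πₖ Eₖ[s(v) (s(u) + V)] =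
0` for all `v`.

The blocks are never inverted explicitly: the right-hand side of the component equations,
`velocity`, is shown to satisfy this relation. By Stein's identity (`integral_exp_suff_mul_pd`,
applied once or twice), a function whose Gaussian mean, mean gradient and mean Hessian all vanish is
orthogonal to every polynomial of degree at most two (`integral_exp_suff_mul_quadratic_eq_zero`).
For `s(u) + V + c` in component `k`, these three conditions are respectively the equations for the
log-odds, for `γ` and for `Γ`, with a constant `c` that does not depend on `k`. The contribution of
`c` cancels after averaging over the labels. This is `compE_jscore_mul_eq_zero` and
`approxFIM_mulVec_velocity`; positive definiteness (`approxFIM_posDef`) then gives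
`flowField_eq_velocity`.

The analysis rests on openness of `Θ`. Adding `ε` times the identity to each `Γ` stays in `Θ` for
small `ε > 0` and multiplies the Gaussian by a constant times `exp (ε ‖x‖²)`, so mere finiteness of
expectations on `Θ` upgrades to `ExpIntegrable`. That reserve pays for polynomial factors in the
integrations by parts and for the dominating functions when differentiating under the integral. The
quantities coming from the mixture itself are `SubGauss`, so they cost only an arbitrarily small
part of it. -/

/-- `f` grows slower than `exp (δ ‖x‖²)` for every `δ > 0`. -/
def SubGauss {n : ℕ} (f : Vec n → ℝ) : Prop :=
  ∀ δ > 0, ∃ C, ∀ x, |f x| ≤ C * Real.exp (δ * ‖x‖ ^ 2)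

/-- `exp u * f` remains integrable after a small increase of the quadratic part of `u`. -/
def ExpIntegrable {n : ℕ} (u f : Vec n → ℝ) : Prop :=
  ∃ ε > 0, Integrable (fun x => Real.exp (u x + ε * ‖x‖ ^ 2) * f x)

variable {n m d : ℕ} {f g u : Vec n → ℝ}

theorem SubGauss.exists_nonneg (hf : SubGauss f) {δ : ℝ} (hδ : 0 < δ) :
    ∃ C, 0 ≤ C ∧ ∀ x, |f x| ≤ C * Real.exp (δ * ‖x‖ ^ 2) := by
  obtain ⟨C, hC⟩ := hf δ hδ
  refine ⟨C, ?_, hC⟩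
  by_contra! h
  have := hC 0
  have h2 : C * Real.exp (δ * ‖(0 : Vec n)‖ ^ 2) < 0 := mul_neg_of_neg_of_pos h (Real.exp_pos _)
  linarith [abs_nonneg (f 0)]

theorem SubGauss.mono (hg : SubGauss g) (h : ∀ x, |f x| ≤ |g x|) : SubGauss f := fun δ hδ => by
  obtain ⟨C, hC⟩ := hg δ hδ
  exact ⟨C, fun x => (h x).trans (hC x)⟩

theorem SubGauss.abs (hf : SubGauss f) : SubGauss (fun x => |f x|) :=
  hf.mono fun x => by simp

theorem SubGauss.neg (hf : SubGauss f) : SubGauss (fun x => -f x) :=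
  hf.mono fun x => by simp

theorem SubGauss.add (hf : SubGauss f) (hg : SubGauss g) : SubGauss (fun x => f x + g x) :=
  fun δ hδ => by
  obtain ⟨C, hC⟩ := hf δ hδ
  obtain ⟨D, hD⟩ := hg δ hδ
  exact ⟨C + D, fun x => (abs_add_le _ _).trans (by linarith [hC x, hD x])⟩

theorem SubGauss.sub (hf : SubGauss f) (hg : SubGauss g) : SubGauss (fun x => f x - g x) := by
  simpa [sub_eq_add_neg] using hf.add hg.neg

/-- Each factor is allowed half of the exponent `δ`. -/
theorem SubGauss.mul (hf : SubGauss f) (hg : SubGauss g) : SubGauss (fun x => f x * g x) :=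
  fun δ hδ => by
  obtain ⟨C, hC0, hC⟩ := hf.exists_nonneg (half_pos hδ)
  obtain ⟨D, hD0, hD⟩ := hg.exists_nonneg (half_pos hδ)
  refine ⟨C * D, fun x => ?_⟩
  have e : Real.exp (δ * ‖x‖ ^ 2) = Real.exp (δ / 2 * ‖x‖ ^ 2) * Real.exp (δ / 2 * ‖x‖ ^ 2) := by
    rw [← Real.exp_add]; ring_nf
  rw [abs_mul, e]
  calc |f x| * |g x| ≤ (C * Real.exp (δ / 2 * ‖x‖ ^ 2)) * (D * Real.exp (δ / 2 * ‖x‖ ^ 2)) :=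
        mul_le_mul (hC x) (hD x) (abs_nonneg _) (by positivity)
    _ = _ := by ring

theorem SubGauss.const (c : ℝ) : SubGauss (fun _ : Vec n => c) := fun δ hδ =>
  ⟨|c|, fun x => le_mul_of_one_le_right (abs_nonneg c) (Real.one_le_exp (by positivity))⟩

theorem SubGauss.sum {ι : Type*} (s : Finset ι) {F : ι → Vec n → ℝ}
    (h : ∀ i ∈ s, SubGauss (F i)) : SubGauss (fun x => ∑ i ∈ s, F i x) := by
  classical
  induction s using Finset.induction_on with
  | empty => simpa using SubGauss.const (n := n) 0
  | insert a s ha ih =>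
    simp only [Finset.sum_insert ha]
    exact (h a (by simp)).add (ih fun i hi => h i (by simp [hi]))

theorem SubGauss.norm_sq : SubGauss (fun x : Vec n => ‖x‖ ^ 2) := fun δ hδ =>
  ⟨δ⁻¹, fun x => by
    rw [abs_of_nonneg (by positivity)]
    have := Real.add_one_le_exp (δ * ‖x‖ ^ 2)
    rw [inv_mul_eq_div, le_div_iff₀ hδ]
    linarith⟩

theorem abs_coord_le (x : Vec n) (i : Fin n) : |x i| ≤ ‖x‖ := by
  simpa using PiLp.norm_apply_le x i

theorem abs_coord_le' (x : Vec n) (i : Fin n) : |x i| ≤ 1 + ‖x‖ ^ 2 := by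
  nlinarith [abs_coord_le x i, sq_nonneg (‖x‖ - 1), norm_nonneg x]

theorem SubGauss.one_add_norm_sq : SubGauss (fun x : Vec n => 1 + ‖x‖ ^ 2) :=
  (SubGauss.const 1).add .norm_sq

theorem SubGauss.coord (i : Fin n) : SubGauss (fun x : Vec n => x i) :=
  SubGauss.one_add_norm_sq.mono fun x => (abs_coord_le' x i).trans (le_abs_self _)

theorem integrable_exp_mul_of_le {ε δ : ℝ} (hδ : δ ≤ ε)
    (h : Integrable (fun x => Real.exp (u x + ε * ‖x‖ ^ 2) * f x)) :
    Integrable (fun x => Real.exp (u x + δ * ‖x‖ ^ 2) * f x) := by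
  have := h.bdd_mul (c := 1) (f := fun x => Real.exp (-((ε - δ) * ‖x‖ ^ 2)))
    (by fun_prop) (.of_forall fun x => by
      rw [Real.norm_eq_abs, Real.abs_exp]
      refine Real.exp_le_one_iff.2 ?_
      have : 0 ≤ ε - δ := by linarith
      simp only [Left.neg_nonpos_iff]; positivity)
  refine this.congr (.of_forall fun x => ?_)
  simp only
  rw [← mul_assoc, ← Real.exp_add]
  ring_nf

theorem ExpIntegrable.integrable (h : ExpIntegrable u f) :
    Integrable (fun x => Real.exp (u x) * f x) := by
  obtain ⟨ε, hε, h⟩ := h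
  simpa using integrable_exp_mul_of_le hε.le h

theorem ExpIntegrable.add (hf : ExpIntegrable u f)
    (hg : ExpIntegrable u g) : ExpIntegrable u (fun x => f x + g x) := by
  obtain ⟨ε, hε, hf⟩ := hf
  obtain ⟨δ, hδ, hg⟩ := hg
  refine ⟨min ε δ, lt_min hε hδ, ?_⟩
  have := (integrable_exp_mul_of_le (min_le_left ε δ) hf).add
    (integrable_exp_mul_of_le (min_le_right ε δ) hg)
  refine this.congr (.of_forall fun x => ?_)
  simp [mul_add]

/-- Half of the reserve `ε` absorbs `f`, which is bounded after multiplication by `exp (-(ε / 2)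
‖x‖²)`; the other half remains as the reserve of the product. -/
theorem ExpIntegrable.subGauss_mul (hf : SubGauss f) (hfc : Continuous f)
    (hg : ExpIntegrable u g) : ExpIntegrable u (fun x => f x * g x) := by
  obtain ⟨ε, hε, hg⟩ := hg
  refine ⟨ε / 2, half_pos hε, ?_⟩
  obtain ⟨C, hC⟩ := hf (ε / 2) (half_pos hε)
  have := hg.bdd_mul (c := C) (f := fun x => Real.exp (-(ε / 2 * ‖x‖ ^ 2)) * f x)
    (by fun_prop) (.of_forall fun x => by
      rw [Real.norm_eq_abs, abs_mul, Real.abs_exp, Real.exp_neg, inv_mul_le_iff₀ (Real.exp_pos _)]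
      linarith [hC x])
  refine this.congr (.of_forall fun x => ?_)
  simp only
  have e : Real.exp (u x + ε / 2 * ‖x‖ ^ 2) =
      Real.exp (-(ε / 2 * ‖x‖ ^ 2)) * Real.exp (u x + ε * ‖x‖ ^ 2) := by
    rw [← Real.exp_add]; ring_nf
  rw [e]; ring

theorem ExpIntegrable.const_mul (c : ℝ) (hg : ExpIntegrable u g) :
    ExpIntegrable u (fun x => c * g x) :=
  hg.subGauss_mul (.const c) continuous_const

theorem ExpIntegrable.neg (hg : ExpIntegrable u g) : ExpIntegrable u (fun x => -g x) := by
  simpa using hg.const_mul (-1)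

theorem ExpIntegrable.abs (hg : ExpIntegrable u g) :
    ExpIntegrable u (fun x => |g x|) := by
  obtain ⟨ε, hε, hg⟩ := hg
  exact ⟨ε, hε, hg.norm.congr (.of_forall fun x => by simp)⟩

theorem SubGauss.expIntegrable (hf : SubGauss f) (hfc : Continuous f)
    (h1 : ExpIntegrable u (fun _ => 1)) : ExpIntegrable u f := by
  simpa using h1.subGauss_mul hf hfc

/-! ### Partial derivatives, gradient and Hessian -/

/-- The partial derivative in the `i`th coordinate. -/
def pd (i : Fin n) (f : Vec n → ℝ) (x : Vec n) : ℝ := fderiv ℝ f x (EuclideanSpace.single i 1)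

theorem gradient_apply (f : Vec n → ℝ) (x : Vec n) (i : Fin n) : gradient f x i = pd i f x := by
  rw [pd, ← toDual_gradient (𝕜 := ℝ) (f := f) (x := x), InnerProductSpace.toDual_apply_apply,
    EuclideanSpace.inner_single_right]
  simp

theorem contDiff_gradient {f : Vec n → ℝ} (hf : ContDiff ℝ 2 f) : ContDiff ℝ 1 (gradient f) := by
  have h1 : ContDiff ℝ 1 (fderiv ℝ f) := hf.fderiv_right (by norm_num)
  exact ((InnerProductSpace.toDual ℝ (Vec n)).symm.contDiff.restrict_scalars ℝ).comp h1

theorem contDiff_pd {f : Vec n → ℝ} (hf : ContDiff ℝ 2 f) (i : Fin n) : ContDiff ℝ 1 (pd i f) := by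
  have h1 : ContDiff ℝ 1 (fderiv ℝ f) := hf.fderiv_right (by norm_num)
  exact h1.clm_apply contDiff_const

theorem continuous_pd {f : Vec n → ℝ} (hf : ContDiff ℝ 1 f) (i : Fin n) : Continuous (pd i f) :=
  (hf.continuous_fderiv (by norm_num)).clm_apply continuous_const

/-- This turns the Jacobian of the gradient into iterated scalar partial derivatives, the form in
which integration by parts is carried out. -/
theorem hessian_apply {f : Vec n → ℝ} (hf : ContDiff ℝ 2 f) (x : Vec n) (i j : Fin n) :
    hessian f x i j = pd j (pd i f) x := by
  have hd : DifferentiableAt ℝ (gradient f) x :=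
    ((contDiff_gradient hf).differentiable (by norm_num)) x
  have h := (EuclideanSpace.proj (𝕜 := ℝ) i : Vec n →L[ℝ] ℝ).hasFDerivAt.comp x hd.hasFDerivAt
  have e : (pd i f) = (EuclideanSpace.proj (𝕜 := ℝ) i : Vec n →L[ℝ] ℝ) ∘ gradient f := by
    ext y; simp [gradient_apply]
  rw [hessian, Matrix.of_apply]
  conv_rhs => rw [pd, e, h.fderiv]
  simp

theorem pd_comm {f : Vec n → ℝ} (hf : ContDiff ℝ 2 f) (x : Vec n) (i j : Fin n) :
    pd j (pd i f) x = pd i (pd j f) x := by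
  have hd : DifferentiableAt ℝ (fderiv ℝ f) x :=
    ((hf.fderiv_right (m := 1) (by norm_num)).differentiable (by norm_num)) x
  have key (k l : Fin n) : pd k (pd l f) x = fderiv ℝ (fderiv ℝ f) x
      (EuclideanSpace.single k 1) (EuclideanSpace.single l 1) := by
    unfold pd
    rw [fderiv_clm_apply hd (differentiableAt_const _)]
    simp
  rw [key, key]
  exact (hf.contDiffAt.isSymmSndFDerivAt (by simp)) _ _

theorem pd_add {x : Vec n} (hf : DifferentiableAt ℝ f x) (hg : DifferentiableAt ℝ g x)
    (i : Fin n) : pd i (fun y => f y + g y) x = pd i f x + pd i g x := by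
  simp [pd, fderiv_fun_add hf hg]

theorem pd_sub {x : Vec n} (hf : DifferentiableAt ℝ f x) (hg : DifferentiableAt ℝ g x)
    (i : Fin n) : pd i (fun y => f y - g y) x = pd i f x - pd i g x := by
  simp [pd, fderiv_fun_sub hf hg]

theorem pd_mul {x : Vec n} (hf : DifferentiableAt ℝ f x) (hg : DifferentiableAt ℝ g x)
    (i : Fin n) : pd i (fun y => f y * g y) x = f x * pd i g x + pd i f x * g x := by
  simp [pd, fderiv_fun_mul hf hg]; ring

theorem pd_exp {x : Vec n} (hf : DifferentiableAt ℝ f x) (i : Fin n) :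
    pd i (fun y => Real.exp (f y)) x = Real.exp (f x) * pd i f x := by
  simp [pd, hf.hasFDerivAt.exp.fderiv]

theorem pd_const (c : ℝ) (i : Fin n) (x : Vec n) : pd i (fun _ => c) x = 0 := by
  simp [pd]

theorem pd_sum {ι : Type*} (s : Finset ι) {F : ι → Vec n → ℝ} {x : Vec n}
    (h : ∀ k ∈ s, DifferentiableAt ℝ (F k) x) (i : Fin n) :
    pd i (fun y => ∑ k ∈ s, F k y) x = ∑ k ∈ s, pd i (F k) x := by
  simp [pd, fderiv_fun_sum h]

theorem pd_div {x : Vec n} (hf : DifferentiableAt ℝ f x) (hg : DifferentiableAt ℝ g x)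
    (h0 : g x ≠ 0) (i : Fin n) :
    pd i (fun y => f y / g y) x = pd i f x / g x - (f x / g x) * (pd i g x / g x) := by
  have hinv : DifferentiableAt ℝ (fun y => (g y)⁻¹) x := hg.fun_inv h0
  have h : pd i (fun y => (g y)⁻¹) x = -(pd i g x) / g x ^ 2 := by
    have := (hasDerivAt_inv h0).comp_hasFDerivAt x hg.hasFDerivAt
    rw [pd, show (fun y => (g y)⁻¹) = Inv.inv ∘ g from rfl, this.fderiv]
    simp [pd]
    field_simp
  simp only [div_eq_mul_inv] at h ⊢
  rw [pd_mul hf hinv, h]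
  field_simp
  ring

theorem pd_log {x : Vec n} (hf : DifferentiableAt ℝ f x) (h0 : f x ≠ 0) (i : Fin n) :
    pd i (fun y => Real.log (f y)) x = pd i f x / f x := by
  simp [pd, (hf.hasFDerivAt.log h0).fderiv]; field_simp

/-! ### The pairing of a parameter with the sufficient statistics -/

/-- The linear functional `(γ, Γ) ↦ γᵀ x + xᵀ Γ x`. -/
def suff (x : Vec n) : GParam n →L[ℝ] ℝ :=
  ∑ i, x i • ContinuousLinearMap.proj (Sum.inl i) +
    ∑ i, ∑ j, (x i * x j) • ContinuousLinearMap.proj (Sum.inr ⟨(min i j, max i j), min_le_max⟩)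

/-- The double sum runs over all ordered pairs, so a free coordinate strictly above the diagonal is
counted twice, as the symmetric matrix requires. -/
theorem suff_apply (x : Vec n) (θ : GParam n) :
    suff x θ = ∑ i, x i * θ.gam i + ∑ i, ∑ j, x i * x j * θ.Gam i j := by
  simp [suff, GParam.gam, GParam.Gam]

theorem Gam_symm (θ : GParam n) (i j : Fin n) : θ.Gam i j = θ.Gam j i := by
  simp [GParam.Gam, min_comm, max_comm]

theorem continuous_suff : Continuous (suff : Vec n → GParam n →L[ℝ] ℝ) := by
  unfold suff; fun_prop

theorem continuous_suff_apply (θ : GParam n) : Continuous (fun x : Vec n => suff x θ) :=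
  continuous_suff.clm_apply continuous_const

/-- There are `n` linear and `n ^ 2` quadratic terms, each with coefficient at most `1 + ‖x‖ ^ 2`.
All bounds that are uniform in the parameter rest on this quadratic growth. -/
theorem norm_suff_le (x : Vec n) : ‖suff x‖ ≤ (n + n ^ 2) * (1 + ‖x‖ ^ 2) := by
  have hp (a : GIndex n) : ‖(ContinuousLinearMap.proj a : GParam n →L[ℝ] ℝ)‖ ≤ 1 :=
    ContinuousLinearMap.opNorm_le_bound _ zero_le_one fun v => by simpa using norm_le_pi_norm v a
  have hs (c : ℝ) (a : GIndex n) (hc : |c| ≤ 1 + ‖x‖ ^ 2) :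
      ‖c • (ContinuousLinearMap.proj a : GParam n →L[ℝ] ℝ)‖ ≤ 1 + ‖x‖ ^ 2 := by
    rw [norm_smul, Real.norm_eq_abs]
    calc |c| * _ ≤ (1 + ‖x‖ ^ 2) * 1 := mul_le_mul hc (hp a) (norm_nonneg _) (by positivity)
      _ = _ := mul_one _
  refine (norm_add_le _ _).trans ?_
  have h1 : ‖∑ i, x i • (ContinuousLinearMap.proj (Sum.inl i) : GParam n →L[ℝ] ℝ)‖
      ≤ n * (1 + ‖x‖ ^ 2) := by
    refine (norm_sum_le _ _).trans ((Finset.sum_le_card_nsmul _ _ _ fun i _ =>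
      hs _ _ (abs_coord_le' x i)).trans ?_)
    simp [mul_add]
  have h2 : ‖∑ i, ∑ j, (x i * x j) • (ContinuousLinearMap.proj
      (Sum.inr ⟨(min i j, max i j), min_le_max⟩) : GParam n →L[ℝ] ℝ)‖
      ≤ n ^ 2 * (1 + ‖x‖ ^ 2) := by
    refine (norm_sum_le _ _).trans ((Finset.sum_le_card_nsmul _ _ (n * (1 + ‖x‖ ^ 2)) fun i _ =>
      (norm_sum_le _ _).trans ((Finset.sum_le_card_nsmul _ _ _ fun j _ => hs _ _ ?_).trans ?_)).trans
      ?_)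
    · rw [abs_mul]
      nlinarith [abs_coord_le x i, abs_coord_le x j, abs_nonneg (x i), abs_nonneg (x j),
        mul_le_mul (abs_coord_le x i) (abs_coord_le x j) (abs_nonneg _) (norm_nonneg x)]
    · simp [mul_add]
    · simp only [Finset.card_univ, Fintype.card_fin, nsmul_eq_mul]
      apply le_of_eq; ring
  linarith

theorem SubGauss.suff (θ : GParam n) : SubGauss (fun x : Vec n => suff x θ) := by
  refine ((SubGauss.const ((n + n ^ 2 : ℝ) * ‖θ‖)).mul .one_add_norm_sq).mono fun x => ?_
  rw [← Real.norm_eq_abs]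
  refine ((GMFlow.suff x).le_opNorm θ).trans ((mul_le_mul_of_nonneg_right (norm_suff_le x)
    (norm_nonneg θ)).trans (le_trans (le_of_eq (by ring)) (le_abs_self _)))

/-- The `i`th partial derivative of `x ↦ suff x θ`. -/
def suffGrad (θ : GParam n) (i : Fin n) (x : Vec n) : ℝ := θ.gam i + 2 * ∑ j, θ.Gam i j * x j

theorem contDiff_suff (θ : GParam n) : ContDiff ℝ 2 (fun x : Vec n => suff x θ) := by
  simp only [suff_apply]; fun_prop

theorem contDiff_suffGrad (θ : GParam n) (i : Fin n) : ContDiff ℝ 2 (suffGrad θ i) := by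
  unfold suffGrad; fun_prop

theorem differentiable_suff (θ : GParam n) : Differentiable ℝ (fun x : Vec n => suff x θ) :=
  (contDiff_suff θ).differentiable (by norm_num)

theorem pd_coord (i j : Fin n) (x : Vec n) :
    pd i (fun y : Vec n => y j) x = if j = i then 1 else 0 := by
  have h : HasFDerivAt (fun y : Vec n => y j) (EuclideanSpace.proj (𝕜 := ℝ) j : Vec n →L[ℝ] ℝ) x :=
    (EuclideanSpace.proj (𝕜 := ℝ) j : Vec n →L[ℝ] ℝ).hasFDerivAt
  simp [pd, h.fderiv]

theorem pd_suff (θ : GParam n) (i : Fin n) (x : Vec n) :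
    pd i (fun x : Vec n => suff x θ) x = suffGrad θ i x := by
  have hc (j : Fin n) : DifferentiableAt ℝ (fun y : Vec n => y j) x := by fun_prop
  simp only [suff_apply]
  rw [pd_add (by fun_prop) (by fun_prop), pd_sum _ (by fun_prop), pd_sum _ (by fun_prop)]
  have h1 : ∀ k, pd i (fun y : Vec n => y k * θ.gam k) x = if k = i then θ.gam k else 0 := by
    intro k
    rw [pd_mul (hc k) (by fun_prop), pd_const, pd_coord]
    split_ifs <;> simp
  have h2 : ∀ k, pd i (fun y : Vec n => ∑ l, y k * y l * θ.Gam k l) x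
      = x k * θ.Gam k i + if k = i then ∑ l, θ.Gam i l * x l else 0 := by
    intro k
    rw [pd_sum _ (by fun_prop)]
    have h3 : ∀ l, pd i (fun y : Vec n => y k * y l * θ.Gam k l) x
        = (if l = i then x k * θ.Gam k l else 0) + if k = i then θ.Gam k l * x l else 0 := by
      intro l
      rw [pd_mul (by fun_prop) (by fun_prop), pd_const, pd_mul (hc k) (hc l), pd_coord, pd_coord]
      split_ifs <;> ring
    simp only [h3, Finset.sum_add_distrib, Finset.sum_ite_eq', Finset.mem_univ, if_true]
    congr 1
    by_cases hk : k = i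
    · subst hk; simp
    · simp [hk]
  simp only [h1, h2, Finset.sum_add_distrib, Finset.sum_ite_eq', Finset.mem_univ, if_true]
  rw [suffGrad, two_mul]
  congr 2
  exact Finset.sum_congr rfl fun k _ => by rw [Gam_symm θ i k, mul_comm]

theorem pd_suffGrad (θ : GParam n) (i j : Fin n) (x : Vec n) :
    pd j (suffGrad θ i) x = 2 * θ.Gam i j := by
  have hc (j : Fin n) : DifferentiableAt ℝ (fun y : Vec n => y j) x := by fun_prop
  have h : ∀ k, pd j (fun y : Vec n => θ.Gam i k * y k) x = if k = j then θ.Gam i k else 0 := by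
    intro k
    rw [pd_mul (by fun_prop) (hc k), pd_const, pd_coord]
    split_ifs <;> simp
  unfold suffGrad
  rw [pd_add (by fun_prop) (by fun_prop), pd_mul (by fun_prop) (by fun_prop), pd_const, pd_const,
    pd_sum _ (by fun_prop)]
  simp [h]

theorem SubGauss.suffGrad (θ : GParam n) (i : Fin n) : SubGauss (suffGrad θ i) :=
  (SubGauss.const _).add ((SubGauss.const 2).mul
    (SubGauss.sum _ fun j _ => (SubGauss.const _).mul (.coord j)))

/-! ### Integration by parts against a Gaussian weight -/

section Stein

variable {θ : GParam n}

/-- Stein's identity: the partial derivative of the weight is the weight times `suffGrad`, and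
integrability of the three products leaves no boundary term. -/
theorem integral_exp_suff_mul_pd (hf : Differentiable ℝ f) (hfi : ExpIntegrable (suff · θ) f)
    (i : Fin n) (hdi : ExpIntegrable (suff · θ) (pd i f)) :
    ∫ x, Real.exp (suff x θ) * pd i f x =
      -∫ x, Real.exp (suff x θ) * (suffGrad θ i x * f x) := by
  have hd := differentiable_suff θ
  have hpd (x : Vec n) : fderiv ℝ (fun y : Vec n => Real.exp (suff y θ)) x
      (EuclideanSpace.single i 1) * f x = Real.exp (suff x θ) * (suffGrad θ i x * f x) := by
    have := pd_exp (hd x) i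
    rw [pd_suff] at this
    rw [← mul_assoc, ← this, pd]
  have := integral_mul_fderiv_eq_neg_fderiv_mul_of_integrable (μ := (volume : Measure (Vec n)))
    (f := fun x => Real.exp (suff x θ)) (g := f) (v := EuclideanSpace.single i 1)
    (by
      simp only [hpd]
      exact (hfi.subGauss_mul (.suffGrad θ i) (contDiff_suffGrad θ i).continuous).integrable)
    (hdi.integrable) (hfi.integrable) (fun x _ => (hd x).exp) (fun x _ => hf x)
  simp only [hpd] at this
  exact this

/-- `suffGrad` is affine in `x` with linear part `2 Γ`. Inverting it lets Stein's identity, which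
produces factors `suffGrad`, speak about coordinates. -/
theorem coord_eq_sum_suffGrad (hθ : IsUnit θ.Gam.det) (x : Vec n) (i : Fin n) :
    x i = ∑ j, (1 / 2 * θ.Gam⁻¹ i j) * (suffGrad θ j x - θ.gam j) := by
  have h : ∀ j, suffGrad θ j x - θ.gam j = 2 * (θ.Gam *ᵥ fun k => x k) j := by
    intro j; simp [suffGrad, Matrix.mulVec, dotProduct]
  have h2 : θ.Gam⁻¹ *ᵥ (θ.Gam *ᵥ fun k => x k) = fun k => x k := by
    rw [Matrix.mulVec_mulVec, Matrix.nonsing_inv_mul _ hθ, Matrix.one_mulVec]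
  have h3 := congrFun h2 i
  rw [Matrix.mulVec, dotProduct] at h3
  rw [← h3]
  refine Finset.sum_congr rfl fun j _ => ?_
  rw [h]; ring

/-- A function whose Gaussian mean, mean gradient and mean Hessian vanish is orthogonal to all
polynomials of degree at most two. -/
theorem integral_exp_suff_mul_quadratic_eq_zero (hθ : IsUnit θ.Gam.det) (hf : ContDiff ℝ 2 f)
    (hfi : ExpIntegrable (suff · θ) f) (hdi : ∀ i, ExpIntegrable (suff · θ) (pd i f))
    (hddi : ∀ i j, ExpIntegrable (suff · θ) (pd j (pd i f)))
    (h0 : ∫ x, Real.exp (suff x θ) * f x = 0)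
    (h1 : ∀ i, ∫ x, Real.exp (suff x θ) * pd i f x = 0)
    (h2 : ∀ i j, ∫ x, Real.exp (suff x θ) * pd j (pd i f) x = 0) (v : GParam n) (c : ℝ) :
    ∫ x, Real.exp (suff x θ) * ((suff x v + c) * f x) = 0 := by
  have hfd := hf.differentiable (by norm_num)
  -- the functions annihilated by integration against `exp (suff x θ) * f x`
  let N : (Vec n → ℝ) → Prop := fun g => SubGauss g ∧ Continuous g ∧
    ∫ x, Real.exp (suff x θ) * (g x * f x) = 0
  have hint {g : Vec n → ℝ} (hg : SubGauss g) (hgc : Continuous g) :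
      Integrable (fun x => Real.exp (suff x θ) * (g x * f x)) :=
    (hfi.subGauss_mul hg hgc).integrable
  have Nadd {g h : Vec n → ℝ} (hg : N g) (hh : N h) : N (fun x => g x + h x) := by
    refine ⟨hg.1.add hh.1, hg.2.1.add hh.2.1, ?_⟩
    simp only [add_mul, mul_add]
    rw [integral_add (hint hg.1 hg.2.1) (hint hh.1 hh.2.1), hg.2.2, hh.2.2, add_zero]
  have Nsmul {g : Vec n → ℝ} (a : ℝ) (hg : N g) : N (fun x => a * g x) := by
    refine ⟨(SubGauss.const a).mul hg.1, continuous_const.mul hg.2.1, ?_⟩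
    have (x : Vec n) : Real.exp (suff x θ) * (a * g x * f x) =
      a * (Real.exp (suff x θ) * (g x * f x)) := by ring
    simp only [this]
    rw [integral_const_mul, hg.2.2, mul_zero]
  have Nconst (a : ℝ) : N (fun _ => a) := by
    have : N (fun _ => 1) := ⟨.const 1, continuous_const, by simpa using h0⟩
    simpa using Nsmul a this
  have Nsum {ι : Type} (s : Finset ι) {F : ι → Vec n → ℝ} (h : ∀ i ∈ s, N (F i)) :
      N (fun x => ∑ i ∈ s, F i x) := by
    classical
    induction s using Finset.induction_on with
    | empty => simpa using Nconst 0
    | insert a s ha ih =>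
      simp only [Finset.sum_insert ha]
      exact Nadd (h a (by simp)) (ih fun i hi => h i (by simp [hi]))
  have Ngrad (i : Fin n) : N (suffGrad θ i) := by
    refine ⟨.suffGrad θ i, (contDiff_suffGrad θ i).continuous, ?_⟩
    have := integral_exp_suff_mul_pd hfd hfi i (hdi i)
    rw [h1] at this; linarith
  -- Two integrations by parts: one moves `∂ⱼ` off `∂ᵢ f`, the other moves `∂ᵢ` off `suffGrad θ j *
  -- f`. The extra term, in which `suffGrad θ j` is differentiated, is a multiple of the mean of `f`
  -- and so vanishes.
  have Ngrad2 (i j : Fin n) : N (fun x => suffGrad θ i x * suffGrad θ j x) := by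
    refine ⟨(SubGauss.suffGrad θ i).mul (.suffGrad θ j),
      (contDiff_suffGrad θ i).continuous.mul (contDiff_suffGrad θ j).continuous, ?_⟩
    have hgd := (contDiff_suffGrad θ j).differentiable (by norm_num)
    have e1 := integral_exp_suff_mul_pd ((contDiff_pd hf i).differentiable (by norm_num)) (hdi i) j
      (hddi i j)
    have hA := (hdi i).subGauss_mul (.suffGrad θ j) (contDiff_suffGrad θ j).continuous
    have hB := hfi.const_mul (2 * θ.Gam j i)
    have epd (x : Vec n) : pd i (fun y => suffGrad θ j y * f y) x
        = suffGrad θ j x * pd i f x + 2 * θ.Gam j i * f x := by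
      rw [pd_mul (hgd x) (hfd x), pd_suffGrad]
    have e2 := integral_exp_suff_mul_pd (θ := θ) (f := fun y => suffGrad θ j y * f y)
      (hgd.mul hfd)
      (hfi.subGauss_mul (.suffGrad θ j) (contDiff_suffGrad θ j).continuous) i
      (by
        have := hA.add hB
        simpa only [← epd] using this)
    simp only [epd, mul_add] at e2
    have e3 : ∫ x, Real.exp (suff x θ) * (2 * θ.Gam j i * f x) = 0 := by
      have (x : Vec n) : Real.exp (suff x θ) * (2 * θ.Gam j i * f x) =
        (2 * θ.Gam j i) * (Real.exp (suff x θ) * f x) := by ring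
      simp only [this]
      rw [integral_const_mul, h0, mul_zero]
    rw [integral_add (hA.integrable) (hB.integrable), e3] at e2
    rw [h2] at e1
    simp only [mul_assoc] at e2 ⊢
    linarith
  have Ncoord (i : Fin n) : N (fun x => x i) := by
    have : N (fun x => ∑ j, (1 / 2 * θ.Gam⁻¹ i j) * (suffGrad θ j x + -θ.gam j)) :=
      Nsum _ fun j _ => Nsmul _ (Nadd (Ngrad j) (Nconst _))
    simpa only [← sub_eq_add_neg, ← coord_eq_sum_suffGrad hθ] using this
  -- Both coordinates are expanded by `coord_eq_sum_suffGrad`; the product then contains only terms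
  -- already known to be annihilated.
  have Ncoord2 (i j : Fin n) : N (fun x => x i * x j) := by
    have : N (fun x => ∑ k, ∑ l, (1 / 2 * θ.Gam⁻¹ i k) * ((1 / 2 * θ.Gam⁻¹ j l) *
        (suffGrad θ k x * suffGrad θ l x + (-θ.gam l) * suffGrad θ k x
          + ((-θ.gam k) * suffGrad θ l x + θ.gam k * θ.gam l)))) :=
      Nsum _ fun k _ => Nsum _ fun l _ => Nsmul _ (Nsmul _ (Nadd (Nadd (Ngrad2 k l)
        (Nsmul _ (Ngrad k))) (Nadd (Nsmul _ (Ngrad l)) (Nconst _))))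
    convert this using 2 with x
    rw [coord_eq_sum_suffGrad hθ x i, coord_eq_sum_suffGrad hθ x j, Finset.sum_mul_sum]
    exact Finset.sum_congr rfl fun k _ => Finset.sum_congr rfl fun l _ => by ring
  have hfin : N (fun x => suff x v + c) := by
    have h : N (fun x => (∑ i, v.gam i * x i) + (∑ i, ∑ j, v.Gam i j * (x i * x j)) + c) :=
      Nadd (Nadd (Nsum _ fun i _ => Nsmul _ (Ncoord i))
        (Nsum _ fun i _ => Nsum _ fun j _ => Nsmul _ (Ncoord2 i j))) (Nconst c)
    simpa only [suff_apply, mul_comm] using h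
  exact hfin.2.2

end Stein

/-! ### Positive definite matrices and Gaussian integrals -/

open scoped MatrixOrder in
theorem exists_transpose_mul_self {M : Matrix (Fin n) (Fin n) ℝ} (hM : M.PosDef) :
    ∃ B : Matrix (Fin n) (Fin n) ℝ, M = Bᵀ * B ∧ B.det ≠ 0 := by
  obtain ⟨B, hB⟩ := CStarAlgebra.nonneg_iff_eq_star_mul_self.1
    (Matrix.nonneg_iff_posSemidef.2 hM.posSemidef)
  refine ⟨B, by simpa [Matrix.star_eq_conjTranspose] using hB, fun h => ?_⟩
  have := hM.det_pos
  rw [hB, Matrix.det_mul, h, mul_zero] at this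
  exact lt_irrefl _ this

theorem norm_sq_toLpLin (B : Matrix (Fin n) (Fin n) ℝ) (x : Vec n) :
    ‖Matrix.toLpLin 2 2 B x‖ ^ 2 = (fun i => x i) ⬝ᵥ ((Bᵀ * B) *ᵥ fun i => x i) := by
  rw [EuclideanSpace.norm_sq_eq, ← Matrix.mulVec_mulVec, Matrix.dotProduct_mulVec,
    Matrix.vecMul_transpose]
  simp [Matrix.toLpLin_apply, dotProduct, pow_two]

theorem det_toLpLin (B : Matrix (Fin n) (Fin n) ℝ) :
    LinearMap.det (Matrix.toLpLin 2 2 B : Vec n →ₗ[ℝ] Vec n) = B.det := by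
  rw [Matrix.toLpLin_eq_toLin, LinearMap.det_toLin]

/-- Writing `M = Bᵀ * B`, the form is `‖B x‖²`, and an injective linear map in finite dimension is
bounded below; `c` is the inverse square of its antilipschitz constant. -/
theorem exists_pos_mul_norm_sq_le {M : Matrix (Fin n) (Fin n) ℝ} (hM : M.PosDef) :
    ∃ c > 0, ∀ x : Vec n, c * ‖x‖ ^ 2 ≤ (fun i => x i) ⬝ᵥ (M *ᵥ fun i => x i) := by
  obtain ⟨B, rfl, hB⟩ := exists_transpose_mul_self hM
  obtain ⟨K, hK, hL⟩ := (Matrix.toLpLin 2 2 B : Vec n →ₗ[ℝ] Vec n).exists_antilipschitzWith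
    (LinearMap.ker_eq_bot.2 (LinearEquiv.ofIsUnitDet (f := (Matrix.toLpLin 2 2 B : Vec n →ₗ[ℝ] Vec n))
      (v := PiLp.basisFun 2 ℝ (Fin n)) (v' := PiLp.basisFun 2 ℝ (Fin n))
      (by rw [Matrix.toLpLin_eq_toLin, LinearMap.toMatrix_toLin]; exact hB.isUnit)).injective)
  have hK' : (0 : ℝ) < K := by exact_mod_cast hK
  refine ⟨((K : ℝ) ^ 2)⁻¹, by positivity, fun x => ?_⟩
  rw [← norm_sq_toLpLin, inv_mul_le_iff₀ (by positivity), ← mul_pow]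
  have := hL.le_mul_norm_sub 0 x
  simp only [neg_add_eq_sub, sub_zero, map_zero] at this
  exact pow_le_pow_left₀ (norm_nonneg _) this 2

/-- Translation by `μ` and the linear substitution `B`, where `M = Bᵀ * B`, reduce to the standard
Gaussian integral; the Jacobian supplies the determinant. -/
theorem integral_exp_neg_half_quadratic {M : Matrix (Fin n) (Fin n) ℝ} (hM : M.PosDef)
    (μ : Fin n → ℝ) :
    ∫ x : Vec n, Real.exp (-(1 / 2) * ((fun i => x i - μ i) ⬝ᵥ (M *ᵥ fun i => x i - μ i))) =
      Real.sqrt ((2 * Real.pi) ^ n / M.det) := by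
  obtain ⟨B, rfl, hB⟩ := exists_transpose_mul_self hM
  let L : Vec n →ₗ[ℝ] Vec n := Matrix.toLpLin 2 2 B
  have h1 : ∫ x : Vec n, Real.exp (-(1 / 2) * ((fun i => x i - μ i) ⬝ᵥ
      ((Bᵀ * B) *ᵥ fun i => x i - μ i))) = ∫ x : Vec n, Real.exp (-(1 / 2) * ‖L x‖ ^ 2) := by
    rw [← integral_sub_right_eq_self (fun x : Vec n => Real.exp (-(1 / 2) * ‖L x‖ ^ 2))
      (WithLp.toLp 2 μ)]
    simp only [L, norm_sq_toLpLin]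
    rfl
  have hL : LinearMap.det L ≠ 0 := by rw [det_toLpLin]; exact hB
  have h2 : ∫ x : Vec n, Real.exp (-(1 / 2) * ‖L x‖ ^ 2)
      = |B.det|⁻¹ * ∫ x : Vec n, Real.exp (-(1 / 2) * ‖x‖ ^ 2) := by
    have hc : Continuous L := L.continuous_of_finiteDimensional
    rw [← integral_map (φ := L) (f := fun x : Vec n => Real.exp (-(1 / 2) * ‖x‖ ^ 2))
      hc.measurable.aemeasurable (by fun_prop),
      Measure.map_linearMap_addHaar_eq_smul_addHaar volume hL, integral_smul_measure, det_toLpLin,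
      ENNReal.toReal_ofReal (abs_nonneg _), abs_inv, smul_eq_mul]
  rw [h1, h2, GaussianFourier.integral_rexp_neg_mul_sq_norm (by norm_num), Matrix.det_mul,
    Matrix.det_transpose, Real.sqrt_div (by positivity), Real.sqrt_mul_self_eq_abs,
    Real.sqrt_eq_rpow, ← Real.rpow_natCast, ← Real.rpow_mul (by positivity), finrank_euclideanSpace,
    Fintype.card_fin, inv_mul_eq_div]
  congr 2 <;> ring

/-! ### The Gaussian as an exponential family -/

/-- The natural parameters of the Gaussians with a positive definite covariance. -/
def gAdmissible (n : ℕ) : Set (GParam n) := {θ | (-θ.Gam).PosDef}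

theorem gAdmissible_posDef {θ : GParam n} (h : θ ∈ gAdmissible n) :
    ((-2 : ℝ) • θ.Gam).PosDef := by
  have := Matrix.PosDef.smul h (a := (2 : ℝ)) (by norm_num)
  simpa using this

theorem gAdmissible_isUnit_det {θ : GParam n} (h : θ ∈ gAdmissible n) : IsUnit θ.Gam.det := by
  have := (Matrix.PosDef.det_pos h).ne'
  rw [Matrix.det_neg] at this
  exact (right_ne_zero_of_mul this).isUnit

theorem quadratic_sum (M : Matrix (Fin n) (Fin n) ℝ) (x : Fin n → ℝ) :
    x ⬝ᵥ (M *ᵥ x) = ∑ i, ∑ j, x i * x j * M i j := by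
  simp only [dotProduct, Matrix.mulVec, Finset.mul_sum]
  exact Finset.sum_congr rfl fun i _ => Finset.sum_congr rfl fun j _ => by ring

theorem isOpen_gAdmissible : IsOpen (gAdmissible n) := by
  rw [Metric.isOpen_iff]
  intro θ hθ
  obtain ⟨c, hc, h⟩ := exists_pos_mul_norm_sq_le hθ
  -- A perturbation of the parameter by `r` changes the quadratic form by at most `n ^ 2 * r * ‖x‖ ^
  -- 2`, which must stay below the coercivity margin `c * ‖x‖ ^ 2`. The added `1` keeps the
  -- denominator positive when `n = 0`.
  refine ⟨c / (n ^ 2 + 1), by positivity, fun θ' hθ' => ?_⟩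
  rw [Metric.mem_ball, dist_eq_norm] at hθ'
  refine Matrix.PosDef.of_dotProduct_mulVec_pos ?_ fun x hx => ?_
  · ext i j; simp [Gam_symm θ' i j]
  have hx' : (0 : ℝ) < ‖(WithLp.toLp 2 x : Vec n)‖ := norm_pos_iff.2 (by simpa using hx)
  have h1 := h (WithLp.toLp 2 x)
  simp only [star_trivial] at *
  rw [quadratic_sum] at h1 ⊢
  set y : Vec n := WithLp.toLp 2 x
  have h2 : |∑ i, ∑ j, x i * x j * ((θ' - θ).Gam i j)| ≤ n ^ 2 * (‖y‖ ^ 2 * ‖θ' - θ‖) := by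
    refine (Finset.abs_sum_le_sum_abs _ _).trans ((Finset.sum_le_card_nsmul _ _
      (n * (‖y‖ ^ 2 * ‖θ' - θ‖)) fun i _ => (Finset.abs_sum_le_sum_abs _ _).trans
      ((Finset.sum_le_card_nsmul _ _ (‖y‖ ^ 2 * ‖θ' - θ‖) fun j _ => ?_).trans
      (by simp))).trans (le_of_eq (by simp; ring)))
    rw [abs_mul, abs_mul, pow_two]
    exact mul_le_mul (mul_le_mul (abs_coord_le y i) (abs_coord_le y j) (abs_nonneg _)
      (norm_nonneg _)) (norm_le_pi_norm (θ' - θ) _) (abs_nonneg _) (by positivity)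
  have h3 : ∑ i, ∑ j, x i * x j * (-θ'.Gam) i j = ∑ i, ∑ j, x i * x j * (-θ.Gam) i j -
      ∑ i, ∑ j, x i * x j * ((θ' - θ).Gam i j) := by
    simp only [← Finset.sum_sub_distrib]
    refine Finset.sum_congr rfl fun i _ => Finset.sum_congr rfl fun j _ => ?_
    simp [GParam.Gam]; ring
  have h4 : (n : ℝ) ^ 2 * (‖y‖ ^ 2 * ‖θ' - θ‖) < c * ‖y‖ ^ 2 := by
    rw [lt_div_iff₀ (by positivity)] at hθ'
    have hy2 : 0 < ‖y‖ ^ 2 := by positivity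
    nlinarith [norm_nonneg (θ' - θ)]
  rw [h3]
  have := le_abs_self (∑ i, ∑ j, x i * x j * ((θ' - θ).Gam i j))
  have h5 : c * ‖y‖ ^ 2 ≤ ∑ i, ∑ j, x i * x j * (-θ.Gam) i j := h1
  linarith

/-- The log-partition function. -/
def logZ (θ : GParam n) : ℝ :=
  1 / 2 * (n * Real.log (2 * Real.pi) - Real.log ((-2 : ℝ) • θ.Gam).det)
    + 1 / 2 * (θ.gam ⬝ᵥ (θ.cov *ᵥ θ.gam))

/-- Completing the square: symmetry of `P = -2 Γ` and `P μ = γ` turn the cross terms into `γᵀ x`. -/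
theorem gaussPDF_quadratic {θ : GParam n} (hθ : θ ∈ gAdmissible n) (x : Vec n) :
    -(1 / 2) * ((fun i => x i - θ.mean i) ⬝ᵥ (((-2 : ℝ) • θ.Gam) *ᵥ fun i => x i - θ.mean i))
      = suff x θ - 1 / 2 * (θ.gam ⬝ᵥ (θ.cov *ᵥ θ.gam)) := by
  set P := (-2 : ℝ) • θ.Gam with hP
  have hPs : Pᵀ = P := by ext i j; simp [hP, Gam_symm θ i j]
  have hPm : P *ᵥ θ.mean = θ.gam := by
    rw [GParam.mean, GParam.cov, Matrix.mulVec_mulVec,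
      Matrix.mul_nonsing_inv _ (gAdmissible_posDef hθ).det_pos.ne'.isUnit, Matrix.one_mulVec]
  let y : Fin n → ℝ := fun i => x i
  have e : (fun i => x i - θ.mean i) = y - θ.mean := rfl
  have hs : θ.mean ⬝ᵥ (P *ᵥ y) = θ.gam ⬝ᵥ y := by
    rw [Matrix.dotProduct_mulVec, ← Matrix.mulVec_transpose, hPs, hPm]
  rw [e, Matrix.mulVec_sub, hPm, sub_dotProduct, dotProduct_sub, dotProduct_sub, hs, suff_apply,
    dotProduct_comm y θ.gam]
  have h1 : θ.gam ⬝ᵥ y = ∑ i, x i * θ.gam i := by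
    simp only [dotProduct, y]; exact Finset.sum_congr rfl fun i _ => mul_comm _ _
  have h2 : y ⬝ᵥ (P *ᵥ y) = -2 * ∑ i, ∑ j, x i * x j * θ.Gam i j := by
    rw [quadratic_sum]
    simp only [Finset.mul_sum]
    refine Finset.sum_congr rfl fun i _ => Finset.sum_congr rfl fun j _ => ?_
    simp [hP, y]; ring
  have h3 : θ.mean ⬝ᵥ θ.gam = θ.gam ⬝ᵥ (θ.cov *ᵥ θ.gam) := by
    rw [dotProduct_comm, GParam.mean]
  rw [h1, h2, h3]
  ring

theorem natGauss_eq_exp {θ : GParam n} (hθ : θ ∈ gAdmissible n) (x : Vec n) :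
    natGauss θ x = Real.exp (suff x θ - logZ θ) := by
  have hd := (gAdmissible_posDef hθ).det_pos
  have hinv : θ.cov⁻¹ = (-2 : ℝ) • θ.Gam := by
    rw [GParam.cov, Matrix.nonsing_inv_nonsing_inv _ hd.ne'.isUnit]
  have hdet : θ.cov.det = ((-2 : ℝ) • θ.Gam).det⁻¹ := by
    rw [GParam.cov, Matrix.det_nonsing_inv, Ring.inverse_eq_inv']
  rw [natGauss, gaussPDF, hinv, gaussPDF_quadratic hθ, hdet, logZ]
  have h1 : (Real.sqrt ((2 * Real.pi) ^ n * ((-2 : ℝ) • θ.Gam).det⁻¹))⁻¹ =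
      Real.exp (-(1 / 2 * (n * Real.log (2 * Real.pi) - Real.log ((-2 : ℝ) • θ.Gam).det))) := by
    rw [Real.exp_neg]
    congr 1
    have hp : 0 < (2 * Real.pi) ^ n * ((-2 : ℝ) • θ.Gam).det⁻¹ := by positivity
    rw [← Real.exp_log (Real.sqrt_pos.2 hp), Real.log_sqrt hp.le, Real.log_mul (by positivity)
      (by positivity), Real.log_pow, Real.log_inv]
    ring_nf
  rw [h1, ← Real.exp_add]
  ring_nf

theorem integral_natGauss {θ : GParam n} (hθ : θ ∈ gAdmissible n) : ∫ x, natGauss θ x = 1 := by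
  have hd := (gAdmissible_posDef hθ).det_pos
  have hinv : θ.cov⁻¹ = (-2 : ℝ) • θ.Gam := by
    rw [GParam.cov, Matrix.nonsing_inv_nonsing_inv _ hd.ne'.isUnit]
  have hdet : θ.cov.det = ((-2 : ℝ) • θ.Gam).det⁻¹ := by
    rw [GParam.cov, Matrix.det_nonsing_inv, Ring.inverse_eq_inv']
  simp only [natGauss, gaussPDF, hinv, hdet]
  rw [integral_const_mul, integral_exp_neg_half_quadratic (gAdmissible_posDef hθ), div_eq_mul_inv]
  exact inv_mul_cancel₀ (Real.sqrt_pos.2 (by positivity)).ne'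

theorem natGauss_pos {θ : GParam n} (hθ : θ ∈ gAdmissible n) (x : Vec n) : 0 < natGauss θ x := by
  rw [natGauss_eq_exp hθ]; exact Real.exp_pos _

/-- The Bochner integral of a non-integrable function is zero, so total mass one already forces
integrability. -/
theorem integrable_natGauss {θ : GParam n} (hθ : θ ∈ gAdmissible n) :
    Integrable (natGauss θ) :=
  .of_integral_ne_zero (by rw [integral_natGauss hθ]; exact one_ne_zero)

theorem contDiff_det {E : Type*} [NormedAddCommGroup E] [NormedSpace ℝ E] {N : ℕ∞}
    {M : E → Matrix (Fin n) (Fin n) ℝ} (hM : ∀ i j, ContDiff ℝ N fun e => M e i j) :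
    ContDiff ℝ N fun e => (M e).det := by
  simp only [Matrix.det_apply]
  exact ContDiff.sum fun σ _ => (contDiff_prod fun i _ => hM _ _).const_smul _

theorem contDiff_neg_two_smul_Gam {N : ℕ∞} (i j : Fin n) :
    ContDiff ℝ N fun θ : GParam n => ((-2 : ℝ) • θ.Gam) i j := by
  simp only [Matrix.smul_apply, GParam.Gam, Matrix.of_apply]
  fun_prop

/-- By the adjugate formula the covariance entries are rational in the parameter, with denominator
`det (-2 Γ)`, which is nonzero here. -/
theorem contDiffAt_logZ {θ : GParam n} (hθ : θ ∈ gAdmissible n) : ContDiffAt ℝ 1 logZ θ := by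
  have hd := (gAdmissible_posDef hθ).det_pos.ne'
  have hdet : ContDiffAt ℝ 1 (fun θ : GParam n => ((-2 : ℝ) • θ.Gam).det) θ :=
    (contDiff_det (N := 1) contDiff_neg_two_smul_Gam).contDiffAt
  have hadj (i j : Fin n) : ContDiffAt ℝ 1
      (fun θ : GParam n => ((-2 : ℝ) • θ.Gam).adjugate i j) θ := by
    simp only [Matrix.adjugate_apply]
    refine (contDiff_det (N := 1) fun k l => ?_).contDiffAt
    by_cases hk : k = j
    · subst hk; simp only [Matrix.updateRow_self]; exact contDiff_const
    · simp only [Matrix.updateRow_ne hk]; exact contDiff_neg_two_smul_Gam k l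
  have hcov (i j : Fin n) : ContDiffAt ℝ 1 (fun θ : GParam n => θ.cov i j) θ := by
    have e : (fun θ : GParam n => θ.cov i j) = fun θ : GParam n =>
        ((-2 : ℝ) • θ.Gam).det⁻¹ * ((-2 : ℝ) • θ.Gam).adjugate i j := by
      ext θ
      rw [GParam.cov, Matrix.inv_def, Ring.inverse_eq_inv']
      rfl
    rw [e]
    exact (hdet.inv hd).mul (hadj i j)
  have hgam (i : Fin n) : ContDiffAt ℝ 1 (fun θ : GParam n => θ.gam i) θ := by
    unfold GParam.gam; fun_prop
  unfold logZ
  simp only [dotProduct, Matrix.mulVec]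
  refine (contDiffAt_const.mul (contDiffAt_const.sub (hdet.log hd))).add (contDiffAt_const.mul
    (ContDiffAt.sum fun i _ => (hgam i).mul (ContDiffAt.sum fun j _ => (hcov i j).mul (hgam j))))

/-- The direction in parameter space that adds the identity to `Γ`. -/
def idShift (n : ℕ) : GParam n := Sum.elim 0 fun p => if p.1.1 = p.1.2 then 1 else 0

theorem suff_idShift (x : Vec n) : suff x (idShift n) = ‖x‖ ^ 2 := by
  rw [suff_apply, EuclideanSpace.norm_sq_eq]
  have h (i j : Fin n) : (idShift n).Gam i j = if i = j then 1 else 0 := by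
    rcases le_total i j with hij | hij <;> simp [idShift, GParam.Gam, eq_comm]
  have h' (i : Fin n) : (idShift n).gam i = 0 := by simp [idShift, GParam.gam]
  simp [h, h', pow_two]

/-- Along `idShift` the unnormalized density gains exactly the factor `exp (ε ‖x‖²)`, so a finite
expectation at the shifted parameter is a reserve at the original one. -/
theorem expIntegrable_of_shift {θ : GParam n} {f : Vec n → ℝ} {ε : ℝ} (hε : 0 < ε)
    (hθ : θ + ε • idShift n ∈ gAdmissible n)
    (h : Integrable fun x => natGauss (θ + ε • idShift n) x * f x) :
    ExpIntegrable (suff · θ) f := by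
  refine ⟨ε, hε, (h.const_mul (Real.exp (logZ (θ + ε • idShift n)))).congr
    (.of_forall fun x => ?_)⟩
  simp only [natGauss_eq_exp hθ, map_add, map_smul, suff_idShift, smul_eq_mul]
  rw [← mul_assoc, ← Real.exp_add]
  ring_nf

theorem expIntegrable_one {θ : GParam n} (hθ : θ ∈ gAdmissible n) :
    ExpIntegrable (suff · θ) (fun _ => 1) := by
  have hc : Filter.Tendsto (fun ε : ℝ => θ + ε • idShift n) (nhdsWithin 0 (Set.Ioi 0)) (nhds θ) := by
    have : Continuous (fun ε : ℝ => θ + ε • idShift n) := by fun_prop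
    simpa using (this.tendsto 0).mono_left nhdsWithin_le_nhds
  obtain ⟨ε, h, hε⟩ := ((hc.eventually (isOpen_gAdmissible.mem_nhds hθ)).and
    self_mem_nhdsWithin).exists
  exact expIntegrable_of_shift hε h (by simpa using integrable_natGauss h)

theorem natGauss_mul_eq {θ : GParam n} (hθ : θ ∈ gAdmissible n) (f : Vec n → ℝ) (x : Vec n) :
    natGauss θ x * f x = Real.exp (-logZ θ) * (Real.exp (suff x θ) * f x) := by
  rw [natGauss_eq_exp hθ, ← mul_assoc, ← Real.exp_add]; ring_nf

theorem ExpIntegrable.natGauss_mul {θ : GParam n} (hθ : θ ∈ gAdmissible n) {f : Vec n → ℝ}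
    (h : ExpIntegrable (suff · θ) f) : Integrable (fun x => natGauss θ x * f x) := by
  simp only [natGauss_mul_eq hθ]
  exact h.integrable.const_mul _

theorem integral_natGauss_mul {θ : GParam n} (hθ : θ ∈ gAdmissible n) (f : Vec n → ℝ) :
    ∫ x, natGauss θ x * f x = Real.exp (-logZ θ) * ∫ x, Real.exp (suff x θ) * f x := by
  simp only [natGauss_mul_eq hθ]
  rw [integral_const_mul]

/-! ### The score of the Gaussian -/

/-- The score `∇_θ log q(x; θ)` of the Gaussian. -/
def gscore (θ : GParam n) (x : Vec n) : GParam n →L[ℝ] ℝ := suff x - fderiv ℝ logZ θ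

theorem log_natGauss {θ : GParam n} (hθ : θ ∈ gAdmissible n) (x : Vec n) :
    Real.log (natGauss θ x) = suff x θ - logZ θ := by
  rw [natGauss_eq_exp hθ, Real.log_exp]

theorem hasFDerivAt_log_natGauss {θ : GParam n} (hθ : θ ∈ gAdmissible n) (x : Vec n) :
    HasFDerivAt (fun θ => Real.log (natGauss θ x)) (gscore θ x) θ := by
  have h := (suff x).hasFDerivAt (x := θ) |>.sub
    ((contDiffAt_logZ hθ).differentiableAt (by norm_num)).hasFDerivAt
  refine h.congr_of_eventuallyEq ?_
  filter_upwards [isOpen_gAdmissible.mem_nhds hθ] with θ' hθ'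
  exact log_natGauss hθ' x

theorem hasFDerivAt_natGauss {θ : GParam n} (hθ : θ ∈ gAdmissible n) (x : Vec n) :
    HasFDerivAt (fun θ => natGauss θ x) (natGauss θ x • gscore θ x) θ := by
  have h := (hasFDerivAt_log_natGauss hθ x).exp
  rw [Real.exp_log (natGauss_pos hθ x)] at h
  refine h.congr_of_eventuallyEq ?_
  filter_upwards [isOpen_gAdmissible.mem_nhds hθ] with θ' hθ'
  rw [Real.exp_log (natGauss_pos hθ' x)]

theorem continuous_natGauss {θ : GParam n} (hθ : θ ∈ gAdmissible n) : Continuous (natGauss θ) := by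
  have : natGauss θ = fun x => Real.exp (suff x θ - logZ θ) := funext (natGauss_eq_exp hθ)
  rw [this]
  exact Real.continuous_exp.comp ((continuous_suff_apply θ).sub continuous_const)

theorem continuous_gscore (θ : GParam n) : Continuous (gscore θ) :=
  continuous_suff.sub continuous_const

theorem SubGauss.gscore (θ v : GParam n) : SubGauss (fun x => gscore θ x v) :=
  (SubGauss.suff v).sub (.const _)

/-- `suff x θ' - suff x θ` is at most `‖θ' - θ‖` times a quadratic in `‖x‖`, so nearby densities
exceed the central one by at most a constant times `exp (δ ‖x‖²)`. The other two bounds come from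
local boundedness of `logZ` and of its derivative. -/
theorem gaussian_local_bounds {θ : GParam n} (hθ : θ ∈ gAdmissible n) {δ : ℝ} (hδ : 0 < δ) :
    ∃ C, ∀ᶠ θ' in nhds θ, θ' ∈ gAdmissible n ∧ ∀ x,
      natGauss θ' x ≤ C * Real.exp (suff x θ + δ * ‖x‖ ^ 2) ∧
      ‖gscore θ' x‖ ≤ C * (1 + ‖x‖ ^ 2) ∧ |Real.log (natGauss θ' x)| ≤ C * (1 + ‖x‖ ^ 2) := by
  have hZ := contDiffAt_logZ hθ
  have hc1 := hZ.continuousAt.abs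
  have hc2 : ContinuousAt (fun θ' => ‖fderiv ℝ logZ θ'‖) θ :=
    (hZ.continuousAt_fderiv (by norm_num)).norm
  set a := |logZ θ| + 1
  set b := ‖fderiv ℝ logZ θ‖ + 1
  set N : ℝ := n + n ^ 2
  have hN : 0 ≤ N := by positivity
  -- The sum of the constants needed for the density, the score and the log-density, all
  -- nonnegative, so one `C` serves for the three bounds.
  set C := Real.exp (δ + a) + (N + b) + (N * (‖θ‖ + 1) + a)
  have ha0 : 0 ≤ a := by positivity
  have hb0 : 0 ≤ b := by positivity
  refine ⟨C, ?_⟩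
  filter_upwards [isOpen_gAdmissible.mem_nhds hθ,
    hc1.eventually (gt_mem_nhds (lt_add_one _)), hc2.eventually (gt_mem_nhds (lt_add_one _)),
    Metric.ball_mem_nhds θ (show 0 < δ / (N + 1) by positivity), Metric.ball_mem_nhds θ one_pos]
    with θ' h1 h2 h3 h4 h5
  refine ⟨h1, fun x => ?_⟩
  have hx : 0 ≤ ‖x‖ ^ 2 := by positivity
  have hd : |suff x θ' - suff x θ| ≤ δ * (1 + ‖x‖ ^ 2) := by
    rw [← map_sub, ← Real.norm_eq_abs]
    refine ((suff x).le_opNorm _).trans ?_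
    rw [Metric.mem_ball, dist_eq_norm, lt_div_iff₀ (by positivity)] at h4
    have := norm_suff_le x
    calc ‖suff x‖ * ‖θ' - θ‖ ≤ N * (1 + ‖x‖ ^ 2) * ‖θ' - θ‖ :=
          mul_le_mul_of_nonneg_right this (norm_nonneg _)
      _ = (‖θ' - θ‖ * N) * (1 + ‖x‖ ^ 2) := by ring
      _ ≤ δ * (1 + ‖x‖ ^ 2) := by
          gcongr; nlinarith [norm_nonneg (θ' - θ)]
  have hlogZ := abs_le.1 h2.le
  refine ⟨?_, ?_, ?_⟩
  · rw [natGauss_eq_exp h1]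
    have hC : Real.exp (δ + a) ≤ C := by
      have : 0 ≤ N * (‖θ‖ + 1) := by positivity
      simp only [C]; linarith
    refine le_trans ?_ (mul_le_mul_of_nonneg_right hC (Real.exp_pos _).le)
    rw [← Real.exp_add]
    apply Real.exp_le_exp.2
    have := (abs_le.1 hd).2
    linarith [hlogZ.1]
  · refine (norm_sub_le _ _).trans ?_
    have h6 : ‖suff x‖ ≤ N * (1 + ‖x‖ ^ 2) := norm_suff_le x
    have hC : N + b ≤ C := by
      have : 0 ≤ N * (‖θ‖ + 1) := by positivity
      simp only [C]; linarith [Real.exp_pos (δ + a)]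
    calc ‖suff x‖ + ‖fderiv ℝ logZ θ'‖ ≤ N * (1 + ‖x‖ ^ 2) + b * (1 + ‖x‖ ^ 2) := by nlinarith
      _ = (N + b) * (1 + ‖x‖ ^ 2) := by ring
      _ ≤ _ := by gcongr
  · rw [log_natGauss h1]
    have h6 : |suff x θ'| ≤ N * (‖θ‖ + 1) * (1 + ‖x‖ ^ 2) := by
      rw [← Real.norm_eq_abs]
      refine ((suff x).le_opNorm _).trans ?_
      rw [Metric.mem_ball, dist_eq_norm] at h5
      have h7 : ‖θ'‖ ≤ ‖θ‖ + 1 := by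
        have := norm_le_norm_add_norm_sub' θ' θ
        linarith
      calc ‖suff x‖ * ‖θ'‖ ≤ (N * (1 + ‖x‖ ^ 2)) * (‖θ‖ + 1) :=
            mul_le_mul (norm_suff_le x) h7 (norm_nonneg _) (by positivity)
        _ = _ := by ring
    have hC : N * (‖θ‖ + 1) + a ≤ C := by
      simp only [C]; linarith [Real.exp_pos (δ + a)]
    calc |suff x θ' - logZ θ'| ≤ |suff x θ'| + |logZ θ'| := abs_sub _ _
      _ ≤ N * (‖θ‖ + 1) * (1 + ‖x‖ ^ 2) + a * (1 + ‖x‖ ^ 2) := by nlinarith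
      _ = (N * (‖θ‖ + 1) + a) * (1 + ‖x‖ ^ 2) := by ring
      _ ≤ _ := by gcongr

/-- The score of the Gaussian has mean zero. -/
theorem integral_natGauss_mul_gscore {θ : GParam n} (hθ : θ ∈ gAdmissible n) (v : GParam n) :
    ∫ x, natGauss θ x * gscore θ x v = 0 := by
  obtain ⟨ε, hε, hi⟩ := (SubGauss.one_add_norm_sq (n := n)).expIntegrable (by fun_prop)
    (expIntegrable_one hθ)
  obtain ⟨C, hC⟩ := gaussian_local_bounds hθ hε
  have hcont : Continuous (fun x => natGauss θ x • gscore θ x) :=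
    (continuous_natGauss hθ).smul (continuous_gscore θ)
  have hbound {θ' : GParam n} (h : θ' ∈ gAdmissible n ∧ ∀ x,
      natGauss θ' x ≤ C * Real.exp (suff x θ + ε * ‖x‖ ^ 2) ∧
      ‖gscore θ' x‖ ≤ C * (1 + ‖x‖ ^ 2) ∧ |Real.log (natGauss θ' x)| ≤ C * (1 + ‖x‖ ^ 2))
      (x : Vec n) : ‖natGauss θ' x • gscore θ' x‖ ≤
        C * C * (Real.exp (suff x θ + ε * ‖x‖ ^ 2) * (1 + ‖x‖ ^ 2)) := by
    obtain ⟨h0, h⟩ := h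
    have hp := natGauss_pos h0 x
    rw [norm_smul, Real.norm_eq_abs, abs_of_pos hp]
    calc _ ≤ (C * Real.exp (suff x θ + ε * ‖x‖ ^ 2)) * (C * (1 + ‖x‖ ^ 2)) :=
          mul_le_mul (h x).1 (h x).2.1 (norm_nonneg _) (hp.le.trans (h x).1)
      _ = _ := by ring
  have hder := hasFDerivAt_integral_of_dominated_of_fderiv_le (μ := (volume : Measure (Vec n)))
    (F := fun θ x => natGauss θ x) (F' := fun θ x => natGauss θ x • gscore θ x) (x₀ := θ)
    (bound := fun x => C * C * (Real.exp (suff x θ + ε * ‖x‖ ^ 2) * (1 + ‖x‖ ^ 2))) hC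
    (by
      filter_upwards [isOpen_gAdmissible.mem_nhds hθ] with θ' h
      exact (continuous_natGauss h).aestronglyMeasurable)
    (integrable_natGauss hθ) hcont.aestronglyMeasurable
    (.of_forall fun x θ' h => hbound h x) (hi.const_mul _)
    (.of_forall fun x θ' h => hasFDerivAt_natGauss h.1 x)
  -- The total mass is identically one near `θ`, so the derivative computed under the integral sign
  -- must be zero.
  have hone : HasFDerivAt (fun θ : GParam n => ∫ x, natGauss θ x) (0 : GParam n →L[ℝ] ℝ) θ := by
    refine (hasFDerivAt_const (1 : ℝ) θ).congr_of_eventuallyEq ?_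
    filter_upwards [isOpen_gAdmissible.mem_nhds hθ] with θ' h
    exact integral_natGauss h
  have hI : Integrable (fun x => natGauss θ x • gscore θ x) :=
    (hi.const_mul (C * C)).mono' hcont.aestronglyMeasurable
      (.of_forall fun x => hbound hC.self_of_nhds x)
  have := congrArg (fun L => L v) (hder.unique hone)
  simp only [ContinuousLinearMap.integral_apply hI] at this
  simpa using this

/-! ### The weights -/

/-- The `k`th log-odds as a linear functional of the free ones. -/
def logOddsL (k : Fin (m + 1)) : (Fin m → ℝ) →L[ℝ] ℝ :=
  Fin.lastCases (motive := fun _ => (Fin m → ℝ) →L[ℝ] ℝ) 0 (fun i => ContinuousLinearMap.proj i) k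

theorem logOdds_eq (w : Fin m → ℝ) (k : Fin (m + 1)) : logOdds w k = logOddsL k w := by
  refine Fin.lastCases ?_ (fun i => ?_) k <;> simp [logOdds, logOddsL]

theorem sum_exp_logOdds_pos (w : Fin m → ℝ) : 0 < ∑ j, Real.exp (logOdds w j) :=
  Finset.sum_pos (fun _ _ => Real.exp_pos _) Finset.univ_nonempty

theorem weight_pos (w : Fin m → ℝ) (k : Fin (m + 1)) : 0 < weight w k :=
  div_pos (Real.exp_pos _) (sum_exp_logOdds_pos w)

theorem sum_weight (w : Fin m → ℝ) : ∑ k, weight w k = 1 := by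
  simp only [weight, ← Finset.sum_div]
  exact div_self (sum_exp_logOdds_pos w).ne'

theorem weight_le_one (w : Fin m → ℝ) (k : Fin (m + 1)) : weight w k ≤ 1 := by
  rw [← sum_weight w]
  exact Finset.single_le_sum (fun j _ => (weight_pos w j).le) (Finset.mem_univ k)

/-- The score of the weights. -/
def wscore (w : Fin m → ℝ) (k : Fin (m + 1)) : (Fin m → ℝ) →L[ℝ] ℝ :=
  logOddsL k - ∑ j, weight w j • logOddsL j

theorem hasFDerivAt_log_weight (w : Fin m → ℝ) (k : Fin (m + 1)) :
    HasFDerivAt (fun w => Real.log (weight w k)) (wscore w k) w := by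
  have e : (fun w : Fin m → ℝ => Real.log (weight w k)) =
      fun w => logOddsL k w - Real.log (∑ j, Real.exp (logOddsL j w)) := by
    ext w
    rw [weight, Real.log_div (Real.exp_ne_zero _) (sum_exp_logOdds_pos w).ne', Real.log_exp]
    simp only [logOdds_eq]
  have hs : HasFDerivAt (fun w : Fin m → ℝ => ∑ j, Real.exp (logOddsL j w))
      (∑ j, Real.exp (logOddsL j w) • logOddsL j) w :=
    HasFDerivAt.fun_sum fun j _ => (logOddsL j).hasFDerivAt.exp
  have hp := sum_exp_logOdds_pos w
  simp only [logOdds_eq] at hp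
  rw [e]
  refine ((logOddsL k).hasFDerivAt.sub (hs.log hp.ne')).congr_fderiv ?_
  rw [wscore, Finset.smul_sum]
  congr 1
  refine Finset.sum_congr rfl fun j _ => ?_
  rw [smul_smul, weight]
  simp only [logOdds_eq]
  rw [div_eq_inv_mul]

theorem hasFDerivAt_weight (w : Fin m → ℝ) (k : Fin (m + 1)) :
    HasFDerivAt (fun w => weight w k) (weight w k • wscore w k) w := by
  have h := (hasFDerivAt_log_weight w k).exp
  simpa only [Real.exp_log (weight_pos _ k)] using h

theorem continuous_weight (k : Fin (m + 1)) : Continuous (fun w : Fin m → ℝ => weight w k) :=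
  continuous_iff_continuousAt.2 fun w => (hasFDerivAt_weight w k).continuousAt

/-- Label scores average to zero because the weights sum to one. This is what removes constants
common to all components. -/
theorem sum_weight_mul_wscore (w v : Fin m → ℝ) : ∑ k, weight w k * wscore w k v = 0 := by
  simp only [wscore, sub_apply, mul_sub, Finset.sum_sub_distrib,
    ← Finset.sum_mul, sum_weight]
  simp

/-! ### The joint density and its score -/

/-- The parameters of the `k`th component as a linear map. -/
def compL (k : Fin (m + 1)) : MParam n m →L[ℝ] GParam n :=
  ContinuousLinearMap.pi fun a => ContinuousLinearMap.proj (Sum.inl (a, k))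

/-- The free log-odds as a linear map. -/
def oddsL : MParam n m →L[ℝ] (Fin m → ℝ) :=
  ContinuousLinearMap.pi fun k => ContinuousLinearMap.proj (Sum.inr k)

theorem compL_apply (k : Fin (m + 1)) (η : MParam n m) : compL k η = η.comp k := rfl

theorem isOpen_admissible : IsOpen (admissible n m) := by
  have : admissible n m = ⋂ k : Fin (m + 1), compL k ⁻¹' gAdmissible n := by
    ext η; simp [admissible, gAdmissible, compL_apply]
  rw [this]
  exact isOpen_iInter_of_finite fun k => isOpen_gAdmissible.preimage (compL k).continuous

/-- The score `∇_η log q(x, k; η)` of the joint density. -/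
def jscore (η : MParam n m) (x : Vec n) (k : Fin (m + 1)) : MParam n m →L[ℝ] ℝ :=
  (gscore (η.comp k) x).comp (compL k) + (wscore η.odds k).comp oddsL

theorem jscore_apply (η v : MParam n m) (x : Vec n) (k : Fin (m + 1)) :
    jscore η x k v = gscore (η.comp k) x (v.comp k) + wscore η.odds k v.odds := rfl

theorem jointQ_pos {η : MParam n m} (hη : η ∈ admissible n m) (x : Vec n) (k : Fin (m + 1)) :
    0 < jointQ η (x, k) := mul_pos (natGauss_pos (hη k) x) (weight_pos _ _)

theorem mixture_pos {η : MParam n m} (hη : η ∈ admissible n m) (x : Vec n) : 0 < mixture η x :=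
  Finset.sum_pos (fun k _ => jointQ_pos hη x k) Finset.univ_nonempty

theorem log_jointQ {η : MParam n m} (hη : η ∈ admissible n m) (x : Vec n) (k : Fin (m + 1)) :
    Real.log (jointQ η (x, k)) =
      Real.log (natGauss (η.comp k) x) + Real.log (weight η.odds k) :=
  Real.log_mul (natGauss_pos (hη k) x).ne' (weight_pos _ _).ne'

theorem hasFDerivAt_log_jointQ {η : MParam n m} (hη : η ∈ admissible n m) (x : Vec n)
    (k : Fin (m + 1)) :
    HasFDerivAt (fun η => Real.log (jointQ η (x, k))) (jscore η x k) η := by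
  have h1 := HasFDerivAt.comp η (f := compL k) (hasFDerivAt_log_natGauss (hη k) x)
    (compL k).hasFDerivAt
  have h2 := HasFDerivAt.comp η (f := oddsL) (hasFDerivAt_log_weight η.odds k)
    (oddsL (n := n)).hasFDerivAt
  refine (h1.add h2).congr_of_eventuallyEq ?_
  filter_upwards [isOpen_admissible.mem_nhds hη] with η' hη'
  exact log_jointQ hη' x k

theorem hasFDerivAt_jointQ {η : MParam n m} (hη : η ∈ admissible n m) (x : Vec n)
    (k : Fin (m + 1)) :
    HasFDerivAt (fun η => jointQ η (x, k)) (jointQ η (x, k) • jscore η x k) η := by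
  have h := (hasFDerivAt_log_jointQ hη x k).exp
  rw [Real.exp_log (jointQ_pos hη x k)] at h
  refine h.congr_of_eventuallyEq ?_
  filter_upwards [isOpen_admissible.mem_nhds hη] with η' hη'
  rw [Real.exp_log (jointQ_pos hη' x k)]

theorem continuous_jointQ {η : MParam n m} (hη : η ∈ admissible n m) (k : Fin (m + 1)) :
    Continuous (fun x => jointQ η (x, k)) :=
  (continuous_natGauss (hη k)).mul_const (weight η.odds k)

theorem continuous_jscore (η : MParam n m) (k : Fin (m + 1)) :
    Continuous (fun x => jscore η x k) :=
  ((continuous_gscore _).clm_comp continuous_const).add continuous_const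

theorem SubGauss.jscore (η v : MParam n m) (k : Fin (m + 1)) :
    SubGauss (fun x => jscore η x k v) :=
  (SubGauss.gscore _ _).add (.const _)

/-- The Gaussian bounds transfer since weights are at most one and their scores and logarithms are
continuous in the parameter; summing the constants makes the bound uniform in the label. -/
theorem jointQ_local_bounds {η : MParam n m} (hη : η ∈ admissible n m) {δ : ℝ} (hδ : 0 < δ) :
    ∃ C, 0 ≤ C ∧ ∀ᶠ η' in nhds η, η' ∈ admissible n m ∧ ∀ x k,
      jointQ η' (x, k) ≤ C * Real.exp (suff x (η.comp k) + δ * ‖x‖ ^ 2) ∧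
      ‖jscore η' x k‖ ≤ C * (1 + ‖x‖ ^ 2) ∧
      |Real.log (jointQ η' (x, k))| ≤ C * (1 + ‖x‖ ^ 2) := by
  have key (k : Fin (m + 1)) : ∃ C, 0 ≤ C ∧ ∀ᶠ η' in nhds η, η' ∈ admissible n m ∧ ∀ x,
      jointQ η' (x, k) ≤ C * Real.exp (suff x (η.comp k) + δ * ‖x‖ ^ 2) ∧
      ‖jscore η' x k‖ ≤ C * (1 + ‖x‖ ^ 2) ∧
      |Real.log (jointQ η' (x, k))| ≤ C * (1 + ‖x‖ ^ 2) := by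
    obtain ⟨C, hC⟩ := gaussian_local_bounds (hη k) hδ
    have hC0 : 0 ≤ C := by
      have := (hC.self_of_nhds.2 0).2.1
      simpa using (norm_nonneg _).trans this
    have hC' := (compL k).continuous.continuousAt (x := η) |>.eventually hC
    have hw1 : ContinuousAt (fun η' : MParam n m => ‖wscore η'.odds k‖) η := by
      have : Continuous (fun η' : MParam n m => ‖wscore (oddsL η') k‖) := by
        have h (j : Fin (m + 1)) : Continuous (fun η' : MParam n m => weight (oddsL η') j) :=
          (continuous_weight j).comp (oddsL (n := n)).continuous
        unfold wscore
        fun_prop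
      exact this.continuousAt
    have hw2 : ContinuousAt (fun η' : MParam n m => |Real.log (weight η'.odds k)|) η := by
      have h := ((continuous_weight k).comp (oddsL (n := n) (m := m)).continuous).continuousAt (x := η)
      exact (h.log (weight_pos _ _).ne').abs
    set a := ‖wscore η.odds k‖ + 1
    set b := |Real.log (weight η.odds k)| + 1
    have ha : 0 ≤ a := by positivity
    have hb : 0 ≤ b := by positivity
    have hL : 0 ≤ ‖(compL k : MParam n m →L[ℝ] GParam n)‖ := norm_nonneg _
    have hO : 0 ≤ ‖(oddsL : MParam n m →L[ℝ] Fin m → ℝ)‖ := norm_nonneg _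
    refine ⟨C + (C * ‖(compL k : MParam n m →L[ℝ] GParam n)‖
      + a * ‖(oddsL : MParam n m →L[ℝ] Fin m → ℝ)‖) + (C + b), by positivity, ?_⟩
    filter_upwards [isOpen_admissible.mem_nhds hη, hC',
      hw1.eventually (gt_mem_nhds (lt_add_one _)), hw2.eventually (gt_mem_nhds (lt_add_one _))]
      with η' h1 h2 h3 h4
    refine ⟨h1, fun x => ?_⟩
    obtain ⟨h5, h6, h7⟩ := h2.2 x
    rw [compL_apply] at h5 h6 h7
    have hx : 1 ≤ 1 + ‖x‖ ^ 2 := by nlinarith [sq_nonneg ‖x‖]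
    have hx0 : 0 ≤ 1 + ‖x‖ ^ 2 := by positivity
    refine ⟨?_, ?_, ?_⟩
    · calc jointQ η' (x, k) ≤ natGauss (η'.comp k) x * 1 :=
            mul_le_mul_of_nonneg_left (weight_le_one _ _) (natGauss_pos (h1 k) x).le
        _ ≤ C * Real.exp (suff x (η.comp k) + δ * ‖x‖ ^ 2) := by rw [mul_one]; exact h5
        _ ≤ _ := by
          refine mul_le_mul_of_nonneg_right ?_ (Real.exp_pos _).le
          have := mul_nonneg hC0 hL
          have := mul_nonneg ha hO
          linarith
    · have e1 := ((gscore (η'.comp k) x).opNorm_comp_le (compL k : MParam n m →L[ℝ] GParam n))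
      have e2 := ((wscore η'.odds k).opNorm_comp_le (oddsL : MParam n m →L[ℝ] Fin m → ℝ))
      calc ‖jscore η' x k‖ ≤ _ := norm_add_le _ _
        _ ≤ C * (1 + ‖x‖ ^ 2) * ‖(compL k : MParam n m →L[ℝ] GParam n)‖
            + a * ‖(oddsL : MParam n m →L[ℝ] Fin m → ℝ)‖ :=
          add_le_add (e1.trans (mul_le_mul_of_nonneg_right h6 hL))
            (e2.trans (mul_le_mul_of_nonneg_right h3.le hO))
        _ ≤ C * (1 + ‖x‖ ^ 2) * ‖(compL k : MParam n m →L[ℝ] GParam n)‖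
            + a * ‖(oddsL : MParam n m →L[ℝ] Fin m → ℝ)‖ * (1 + ‖x‖ ^ 2) := by
          exact add_le_add_right (le_mul_of_one_le_right (mul_nonneg ha hO) hx) _
        _ = (C * ‖(compL k : MParam n m →L[ℝ] GParam n)‖
            + a * ‖(oddsL : MParam n m →L[ℝ] Fin m → ℝ)‖) * (1 + ‖x‖ ^ 2) := by ring
        _ ≤ _ := mul_le_mul_of_nonneg_right (by linarith) hx0
    · rw [log_jointQ h1]
      calc _ ≤ _ := abs_add_le _ _
        _ ≤ C * (1 + ‖x‖ ^ 2) + b * (1 + ‖x‖ ^ 2) :=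
          add_le_add h7 (h4.le.trans (le_mul_of_one_le_right hb hx))
        _ = (C + b) * (1 + ‖x‖ ^ 2) := by ring
        _ ≤ _ := by
          refine mul_le_mul_of_nonneg_right ?_ hx0
          have := mul_nonneg hC0 hL
          have := mul_nonneg ha hO
          linarith
  choose C hC0 hC using key
  have hle (k : Fin (m + 1)) : C k ≤ ∑ j, C j :=
    Finset.single_le_sum (fun j _ => hC0 j) (Finset.mem_univ k)
  refine ⟨∑ j, C j, Finset.sum_nonneg fun j _ => hC0 j, ?_⟩
  filter_upwards [Filter.eventually_all.2 hC] with η' h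
  refine ⟨(h 0).1, fun x k => ?_⟩
  obtain ⟨h1, h2, h3⟩ := (h k).2 x
  exact ⟨h1.trans (mul_le_mul_of_nonneg_right (hle k) (Real.exp_pos _).le),
    h2.trans (mul_le_mul_of_nonneg_right (hle k) (by positivity)),
    h3.trans (mul_le_mul_of_nonneg_right (hle k) (by positivity))⟩

/-- From below the mixture dominates one of its terms; from above it is at most `m + 1` times `exp
B`. -/
theorem abs_log_mixture_le {η : MParam n m} (hη : η ∈ admissible n m) (x : Vec n) {B : ℝ}
    (hB : ∀ k, |Real.log (jointQ η (x, k))| ≤ B) :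
    |Real.log (mixture η x)| ≤ B + Real.log (m + 1) := by
  have hm : (0 : ℝ) ≤ Real.log (m + 1) := Real.log_nonneg (by norm_cast; omega)
  rw [abs_le]
  constructor
  · have h1 : jointQ η (x, 0) ≤ mixture η x :=
      Finset.single_le_sum (f := fun k => jointQ η (x, k)) (fun k _ => (jointQ_pos hη x k).le)
        (Finset.mem_univ 0)
    have := Real.log_le_log (jointQ_pos hη x 0) h1
    have := (abs_le.1 (hB 0)).1
    linarith
  · rw [Real.log_le_iff_le_exp (mixture_pos hη x), Real.exp_add, Real.exp_log (by positivity)]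
    refine (Finset.sum_le_card_nsmul _ _ (Real.exp B) fun k _ => ?_).trans (le_of_eq ?_)
    · rw [← Real.log_le_iff_le_exp (jointQ_pos hη x k)]
      exact (abs_le.1 (hB k)).2
    · simp; ring

/-! ### Spatial derivatives of the logarithm of the mixture -/

/-- The average of `a k x` over the label `k`, given the state `x`. -/
def labelAvg (η : MParam n m) (a : Fin (m + 1) → Vec n → ℝ) (x : Vec n) : ℝ :=
  (∑ k, jointQ η (x, k) * a k x) / mixture η x

/-- The average has positive weights summing to one, so it is bounded by the sum of the `|a k|`,
whatever the ratios of the component densities. -/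
theorem SubGauss.labelAvg {η : MParam n m} (hη : η ∈ admissible n m)
    {a : Fin (m + 1) → Vec n → ℝ} (ha : ∀ k, SubGauss (a k)) : SubGauss (labelAvg η a) := by
  refine (SubGauss.sum Finset.univ fun k _ => (ha k).abs).mono fun x => ?_
  rw [GMFlow.labelAvg, abs_div, abs_of_pos (mixture_pos hη x), div_le_iff₀ (mixture_pos hη x)]
  refine (Finset.abs_sum_le_sum_abs _ _).trans (le_trans ?_
    (mul_le_mul_of_nonneg_right (le_abs_self _) (mixture_pos hη x).le))
  rw [Finset.sum_mul]
  refine Finset.sum_le_sum fun k _ => ?_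
  rw [abs_mul, abs_of_pos (jointQ_pos hη x k), mul_comm]
  refine mul_le_mul_of_nonneg_left ?_ (abs_nonneg _)
  exact Finset.single_le_sum (f := fun k => jointQ η (x, k)) (fun k _ => (jointQ_pos hη x k).le)
    (Finset.mem_univ k)

theorem contDiff_jointQ {η : MParam n m} (hη : η ∈ admissible n m) (k : Fin (m + 1)) :
    ContDiff ℝ 2 (fun x => jointQ η (x, k)) := by
  have : (fun x => jointQ η (x, k)) = fun x =>
      Real.exp (suff x (η.comp k) - logZ (η.comp k)) * weight η.odds k := by
    ext x; rw [jointQ, natGauss_eq_exp (hη k)]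
  rw [this]
  exact ((contDiff_suff _).sub contDiff_const).exp.mul contDiff_const

theorem contDiff_mixture {η : MParam n m} (hη : η ∈ admissible n m) :
    ContDiff ℝ 2 (mixture η) := ContDiff.sum fun k _ => contDiff_jointQ hη k

theorem contDiff_log_mixture {η : MParam n m} (hη : η ∈ admissible n m) :
    ContDiff ℝ 2 (fun x => Real.log (mixture η x)) :=
  (contDiff_mixture hη).log fun x => (mixture_pos hη x).ne'

theorem pd_jointQ {η : MParam n m} (hη : η ∈ admissible n m) (k : Fin (m + 1)) (i : Fin n)
    (x : Vec n) :
    pd i (fun x => jointQ η (x, k)) x = jointQ η (x, k) * suffGrad (η.comp k) i x := by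
  have : (fun x => jointQ η (x, k)) = fun x =>
      Real.exp (suff x (η.comp k) - logZ (η.comp k)) * weight η.odds k := by
    ext x; rw [jointQ, natGauss_eq_exp (hη k)]
  have hd := (differentiable_suff (η.comp k)) x
  have e := congrFun this x
  rw [this, e, pd_mul (hd.sub_const _).exp (by fun_prop), pd_const, pd_exp (hd.sub_const _),
    pd_sub hd (by fun_prop), pd_const, pd_suff]
  ring

theorem pd_mixture {η : MParam n m} (hη : η ∈ admissible n m) (i : Fin n) (x : Vec n) :
    pd i (mixture η) x = ∑ k, jointQ η (x, k) * suffGrad (η.comp k) i x := by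
  have e : mixture η = fun x => ∑ k, jointQ η (x, k) := rfl
  rw [e, pd_sum _ fun k _ => (contDiff_jointQ hη k).differentiable (by norm_num) x]
  simp only [pd_jointQ hη]

theorem pd_log_mixture {η : MParam n m} (hη : η ∈ admissible n m) (i : Fin n) :
    pd i (fun x => Real.log (mixture η x)) = labelAvg η fun k => suffGrad (η.comp k) i := by
  ext x
  rw [pd_log ((contDiff_mixture hη).differentiable (by norm_num) x) (mixture_pos hη x).ne',
    pd_mixture hη, labelAvg]

/-- The posterior label weights depend on `x` too; differentiating them produces the covariance of
`a` with `suffGrad` under the label posterior. -/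
theorem pd_labelAvg {η : MParam n m} (hη : η ∈ admissible n m) {a : Fin (m + 1) → Vec n → ℝ}
    (ha : ∀ k, Differentiable ℝ (a k)) (j : Fin n) (x : Vec n) :
    pd j (labelAvg η a) x =
      labelAvg η (fun k x => a k x * suffGrad (η.comp k) j x + pd j (a k) x) x
        - labelAvg η a x * labelAvg η (fun k => suffGrad (η.comp k) j) x := by
  have hq (k : Fin (m + 1)) : DifferentiableAt ℝ (fun x => jointQ η (x, k)) x :=
    (contDiff_jointQ hη k).differentiable (by norm_num) x
  have hqa (k : Fin (m + 1)) : DifferentiableAt ℝ (fun x => jointQ η (x, k) * a k x) x :=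
    (hq k).mul (ha k x)
  have e : labelAvg η a = fun x => (∑ k, jointQ η (x, k) * a k x) / mixture η x := rfl
  rw [e, pd_div (DifferentiableAt.fun_sum fun k _ => hqa k)
    ((contDiff_mixture hη).differentiable (by norm_num) x) (mixture_pos hη x).ne',
    pd_sum _ fun k _ => hqa k, pd_mixture hη]
  congr 2
  refine Finset.sum_congr rfl fun k _ => ?_
  rw [pd_mul (hq k) (ha k x), pd_jointQ hη]
  ring

theorem pd_pd_log_mixture {η : MParam n m} (hη : η ∈ admissible n m) (i j : Fin n) :
    pd j (pd i (fun x => Real.log (mixture η x))) = fun x =>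
      labelAvg η (fun k x => suffGrad (η.comp k) i x * suffGrad (η.comp k) j x
          + 2 * (η.comp k).Gam i j) x
        - labelAvg η (fun k => suffGrad (η.comp k) i) x
          * labelAvg η (fun k => suffGrad (η.comp k) j) x := by
  ext x
  rw [pd_log_mixture hη, pd_labelAvg hη fun k =>
    (contDiff_suffGrad _ i).differentiable (by norm_num)]
  simp only [pd_suffGrad]

theorem SubGauss.pd_log_mixture {η : MParam n m} (hη : η ∈ admissible n m) (i : Fin n) :
    SubGauss (pd i (fun x => Real.log (mixture η x))) := by
  rw [GMFlow.pd_log_mixture hη]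
  exact .labelAvg hη fun k => .suffGrad _ i

theorem SubGauss.pd_pd_log_mixture {η : MParam n m} (hη : η ∈ admissible n m) (i j : Fin n) :
    SubGauss (pd j (pd i (fun x => Real.log (mixture η x)))) := by
  rw [GMFlow.pd_pd_log_mixture hη]
  exact (SubGauss.labelAvg hη fun k => ((SubGauss.suffGrad _ i).mul (.suffGrad _ j)).add
    (.const _)).sub ((SubGauss.labelAvg hη fun k => .suffGrad _ i).mul
      (.labelAvg hη fun k => .suffGrad _ j))

theorem SubGauss.log_mixture {η : MParam n m} (hη : η ∈ admissible n m) :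
    SubGauss (fun x => Real.log (mixture η x)) := by
  obtain ⟨C, -, hC⟩ := jointQ_local_bounds hη one_pos
  refine (((SubGauss.const C).mul .one_add_norm_sq).add (.const (Real.log (m + 1)))).mono
    fun x => ?_
  exact (abs_log_mixture_le hη x fun k => (hC.self_of_nhds.2 x k).2.2).trans (le_abs_self _)

/-! ### Differentiating the relative entropy -/

theorem exists_common_exponent {η : MParam n m} {g : Vec n → ℝ}
    (hg : ∀ k, ExpIntegrable (suff · (η.comp k)) g) :
    ∃ δ > 0, ∀ k, Integrable (fun x => Real.exp (suff x (η.comp k) + δ * ‖x‖ ^ 2) * g x) := by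
  choose ε hε hi using hg
  obtain ⟨k₀, hk₀⟩ := Finite.exists_min ε
  exact ⟨ε k₀, hε k₀, fun k => integrable_exp_mul_of_le (hk₀ k) (hi k)⟩

theorem expIntegrable_of_subGauss {η : MParam n m} (hη : η ∈ admissible n m) {f : Vec n → ℝ}
    (hf : SubGauss f) (hc : Continuous f) (k : Fin (m + 1)) :
    ExpIntegrable (suff · (η.comp k)) f :=
  hf.expIntegrable hc (expIntegrable_one (hη k))

/-- The derivative of `q log q + q g` in the parameters. -/
def entropyDeriv (g : Vec n → ℝ) (η : MParam n m) (x : Vec n) : MParam n m →L[ℝ] ℝ :=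
  (Real.log (mixture η x) + g x + 1) • ∑ k, jointQ η (x, k) • jscore η x k

theorem hasFDerivAt_mixture {η : MParam n m} (hη : η ∈ admissible n m) (x : Vec n) :
    HasFDerivAt (fun η => mixture η x) (∑ k, jointQ η (x, k) • jscore η x k) η :=
  HasFDerivAt.fun_sum fun k _ => hasFDerivAt_jointQ hη x k

theorem hasFDerivAt_mixture_mul_log {η : MParam n m} (hη : η ∈ admissible n m) (g : Vec n → ℝ)
    (x : Vec n) :
    HasFDerivAt (fun η => mixture η x * (Real.log (mixture η x) + g x)) (entropyDeriv g η x) η := by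
  have hm := hasFDerivAt_mixture hη x
  refine (hm.mul ((hm.log (mixture_pos hη x).ne').add_const (g x))).congr_fderiv ?_
  rw [entropyDeriv, smul_smul, mul_inv_cancel₀ (mixture_pos hη x).ne', ← add_smul]
  congr 1
  ring

/-- Dominated differentiation with `g` fixed. The only information used about `g` is continuity and
a Gaussian reserve at the base point, which is why the density bounds had to be uniform near `η`. -/
theorem hasFDerivAt_integral_mixture_mul_log {η : MParam n m} (hη : η ∈ admissible n m)
    {g : Vec n → ℝ} (hgc : Continuous g) (hg : ∀ k, ExpIntegrable (suff · (η.comp k)) g) :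
    Integrable (fun x => mixture η x * (Real.log (mixture η x) + g x)) ∧
    Integrable (entropyDeriv g η) ∧
    HasFDerivAt (fun η => ∫ x, mixture η x * (Real.log (mixture η x) + g x))
      (∫ x, entropyDeriv g η x) η := by
  have hmc {η' : MParam n m} (h : η' ∈ admissible n m) : Continuous (mixture η') :=
    (contDiff_mixture h).continuous
  have hlc {η' : MParam n m} (h : η' ∈ admissible n m) :
      Continuous fun x => Real.log (mixture η' x) := (contDiff_log_mixture h).continuous
  have hInt : Integrable (fun x => mixture η x * (Real.log (mixture η x) + g x)) := by
    simp only [mixture, Finset.sum_mul]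
    refine integrable_finsetSum _ fun k _ => ?_
    have h1 : ExpIntegrable (suff · (η.comp k)) fun x => Real.log (mixture η x) + g x :=
      (expIntegrable_of_subGauss hη (.log_mixture hη) (hlc hη) k).add (hg k)
    refine ((h1.natGauss_mul (hη k)).const_mul (weight η.odds k)).congr (.of_forall fun x => ?_)
    simp only [jointQ, mixture]
    ring
  -- One factor `1 + ‖x‖ ^ 2` accounts for the score, the other for the log-mixture, and `|g x|` for
  -- `g`.
  set G : Vec n → ℝ := fun x => (1 + ‖x‖ ^ 2) * ((1 + ‖x‖ ^ 2) + |g x|)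
  have hG (k : Fin (m + 1)) : ExpIntegrable (suff · (η.comp k)) G :=
    ExpIntegrable.subGauss_mul .one_add_norm_sq (by fun_prop)
      ((expIntegrable_of_subGauss hη .one_add_norm_sq (by fun_prop) k).add (hg k).abs)
  obtain ⟨δ, hδ, hδi⟩ := exists_common_exponent hG
  obtain ⟨C, hC0, hC⟩ := jointQ_local_bounds hη hδ
  set D : ℝ := Real.log (m + 1) + 1
  have hD : 0 ≤ D := add_nonneg (Real.log_nonneg (by norm_cast; omega)) zero_le_one
  set bound : Vec n → ℝ := fun x => ((C + D + 1) * (C * C)) *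
    ∑ k, Real.exp (suff x (η.comp k) + δ * ‖x‖ ^ 2) * G x
  have hbi : Integrable bound := (integrable_finsetSum _ fun k _ => hδi k).const_mul _
  have hbound : ∀ η' : MParam n m, (η' ∈ admissible n m ∧ ∀ x k,
      jointQ η' (x, k) ≤ C * Real.exp (suff x (η.comp k) + δ * ‖x‖ ^ 2) ∧
      ‖jscore η' x k‖ ≤ C * (1 + ‖x‖ ^ 2) ∧
      |Real.log (jointQ η' (x, k))| ≤ C * (1 + ‖x‖ ^ 2)) → ∀ x,
      ‖entropyDeriv g η' x‖ ≤ bound x := by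
    rintro η' ⟨h0, h⟩ x
    have hx : 0 ≤ ‖x‖ ^ 2 := by positivity
    have e1 : |Real.log (mixture η' x) + g x + 1| ≤ (C + D + 1) * ((1 + ‖x‖ ^ 2) + |g x|) := by
      have a1 := abs_log_mixture_le h0 x fun k => (h x k).2.2
      calc _ ≤ |Real.log (mixture η' x) + g x| + |1| := abs_add_le _ _
        _ ≤ |Real.log (mixture η' x)| + |g x| + |1| := by gcongr; exact abs_add_le _ _
        _ ≤ (C * (1 + ‖x‖ ^ 2) + Real.log (m + 1)) + |g x| + 1 := by rw [abs_one]; gcongr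
        _ = C * (1 + ‖x‖ ^ 2) + D + |g x| := by simp only [D]; ring
        _ ≤ _ := by nlinarith [abs_nonneg (g x), mul_nonneg hC0 (abs_nonneg (g x)),
            mul_nonneg hD (abs_nonneg (g x)), mul_nonneg hD hx]
    have e2 : ‖∑ k, jointQ η' (x, k) • jscore η' x k‖ ≤
        ∑ k, (C * Real.exp (suff x (η.comp k) + δ * ‖x‖ ^ 2)) * (C * (1 + ‖x‖ ^ 2)) := by
      refine (norm_sum_le _ _).trans (Finset.sum_le_sum fun k _ => ?_)
      have hp := jointQ_pos h0 x k
      rw [norm_smul, Real.norm_eq_abs, abs_of_pos hp]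
      exact mul_le_mul (h x k).1 (h x k).2.1 (norm_nonneg _) (hp.le.trans (h x k).1)
    rw [entropyDeriv, norm_smul, Real.norm_eq_abs]
    refine (mul_le_mul e1 e2 (norm_nonneg _) (by positivity)).trans (le_of_eq ?_)
    simp only [bound, G, Finset.mul_sum]
    exact Finset.sum_congr rfl fun k _ => by ring
  have hmeas : AEStronglyMeasurable (entropyDeriv g η) (volume : Measure (Vec n)) := by
    refine Continuous.aestronglyMeasurable ?_
    exact (((hlc hη).add hgc).add continuous_const).smul
      (continuous_finsetSum _ fun k _ => (continuous_jointQ hη k).smul (continuous_jscore η k))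
  refine ⟨hInt, hbi.mono' hmeas (.of_forall fun x => hbound η hC.self_of_nhds x), ?_⟩
  exact hasFDerivAt_integral_of_dominated_of_fderiv_le (bound := bound) hC
    (by
      filter_upwards [isOpen_admissible.mem_nhds hη] with η' h
      exact ((hmc h).mul ((hlc h).add hgc)).aestronglyMeasurable)
    hInt hmeas (.of_forall fun x η' h => hbound η' h x) hbi
    (.of_forall fun x η' h => hasFDerivAt_mixture_mul_log h.1 g x)

/-! ### Component expectations -/

theorem ExpIntegrable.compIntegrable {η : MParam n m} (hη : η ∈ admissible n m)
    {k : Fin (m + 1)} {f : Vec n → ℝ} (h : ExpIntegrable (suff · (η.comp k)) f) :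
    CompIntegrable η k f := h.natGauss_mul (hη k)

theorem CompIntegrable.congr {η : MParam n m} {k : Fin (m + 1)} {f g : Vec n → ℝ}
    (h : CompIntegrable η k f) (hfg : ∀ x, f x = g x) : CompIntegrable η k g := by
  rwa [← funext hfg]

theorem compE_add {η : MParam n m} {k : Fin (m + 1)} {f g : Vec n → ℝ}
    (hf : CompIntegrable η k f) (hg : CompIntegrable η k g) :
    compE η k (fun x => f x + g x) = compE η k f + compE η k g := by
  simp only [compE, mul_add]
  exact integral_add hf hg

theorem compE_const_mul (η : MParam n m) (k : Fin (m + 1)) (c : ℝ) (f : Vec n → ℝ) :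
    compE η k (fun x => c * f x) = c * compE η k f := by
  simp only [compE, ← integral_const_mul]
  congr 1; ext x; ring

theorem compE_sum {ι : Type*} (s : Finset ι) {η : MParam n m} {k : Fin (m + 1)}
    {f : ι → Vec n → ℝ} (hf : ∀ i ∈ s, CompIntegrable η k (f i)) :
    compE η k (fun x => ∑ i ∈ s, f i x) = ∑ i ∈ s, compE η k (f i) := by
  simp only [compE, Finset.mul_sum]
  exact integral_finsetSum s hf

theorem compE_const {η : MParam n m} (hη : η ∈ admissible n m) (k : Fin (m + 1)) (c : ℝ) :
    compE η k (fun _ => c) = c := by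
  simp only [compE]
  rw [integral_mul_const, integral_natGauss (hη k), one_mul]

theorem compE_gscore {η : MParam n m} (hη : η ∈ admissible n m) (k : Fin (m + 1)) (v : GParam n) :
    compE η k (fun x => gscore (η.comp k) x v) = 0 :=
  integral_natGauss_mul_gscore (hη k) v

theorem compE_jscore {η : MParam n m} (hη : η ∈ admissible n m) (k : Fin (m + 1))
    (v : MParam n m) : compE η k (fun x => jscore η x k v) = wscore η.odds k v.odds := by
  simp only [jscore_apply]
  rw [compE_add ((expIntegrable_of_subGauss hη (.gscore _ _)
    ((continuous_gscore _).clm_apply continuous_const) k).compIntegrable hη)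
    ((expIntegrable_of_subGauss hη (.const _) continuous_const k).compIntegrable hη),
    compE_gscore hη, compE_const hη, zero_add]

/-- The summand `1` in `entropyDeriv`, from differentiating the logarithm, contributes only the mean
of the joint score, which is zero. -/
theorem integral_entropyDeriv {η : MParam n m} (hη : η ∈ admissible n m)
    {g : Vec n → ℝ} (hgc : Continuous g) (hg : ∀ k, ExpIntegrable (suff · (η.comp k)) g)
    (v : MParam n m) :
    (∫ x, entropyDeriv g η x) v = ∑ k, weight η.odds k *
      compE η k (fun x => jscore η x k v * (Real.log (mixture η x) + g x)) := by
  have hjc (k : Fin (m + 1)) : Continuous fun x => jscore η x k v :=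
    (continuous_jscore η k).clm_apply continuous_const
  have h1 (k : Fin (m + 1)) : ExpIntegrable (suff · (η.comp k))
      fun x => jscore η x k v * (Real.log (mixture η x) + g x) :=
    ExpIntegrable.subGauss_mul (.jscore η v k) (hjc k)
      ((expIntegrable_of_subGauss hη (.log_mixture hη) (contDiff_log_mixture hη).continuous k).add
        (hg k))
  have h2 (k : Fin (m + 1)) : ExpIntegrable (suff · (η.comp k)) fun x => jscore η x k v :=
    expIntegrable_of_subGauss hη (.jscore η v k) (hjc k) k
  have e (x : Vec n) : entropyDeriv g η x v = ∑ k, weight η.odds k * (natGauss (η.comp k) x *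
      (jscore η x k v * (Real.log (mixture η x) + g x) + jscore η x k v)) := by
    simp only [entropyDeriv, smul_apply, sum_apply, smul_eq_mul,
      jointQ, Finset.mul_sum]
    exact Finset.sum_congr rfl fun k _ => by ring
  rw [ContinuousLinearMap.integral_apply (hasFDerivAt_integral_mixture_mul_log hη hgc hg).2.1]
  simp only [e]
  rw [integral_finsetSum _ fun k _ => (((h1 k).add (h2 k)).natGauss_mul (hη k)).const_mul _]
  simp only [integral_const_mul]
  have e2 (k : Fin (m + 1)) : ∫ x, natGauss (η.comp k) x *
      (jscore η x k v * (Real.log (mixture η x) + g x) + jscore η x k v) =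
      compE η k (fun x => jscore η x k v * (Real.log (mixture η x) + g x))
        + wscore η.odds k v.odds := by
    rw [← compE_jscore hη k v]
    exact compE_add ((h1 k).compIntegrable hη) ((h2 k).compIntegrable hη)
  simp only [e2]
  rw [Finset.sum_congr rfl fun k _ => mul_add _ _ _, Finset.sum_add_distrib, sum_weight_mul_wscore,
    add_zero]

/-! ### The approximated Fisher information matrix -/

/-- The label space is finite and discrete, so continuity and integrability may be checked one label
at a time. -/
theorem integrable_prod_count {f : Vec n × Fin (m + 1) → ℝ} (hc : ∀ k, Continuous fun x => f (x, k))
    (hi : ∀ k, Integrable fun x => f (x, k)) :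
    Integrable f ((volume : Measure (Vec n)).prod Measure.count) := by
  have hfc : Continuous f := continuous_prod_of_discrete_right.2 hc
  rw [integrable_prod_iff' hfc.aestronglyMeasurable]
  exact ⟨.of_forall hi, .of_finite⟩

theorem integral_prod_count {f : Vec n × Fin (m + 1) → ℝ} (hc : ∀ k, Continuous fun x => f (x, k))
    (hi : ∀ k, Integrable fun x => f (x, k)) :
    ∫ y, f y ∂((volume : Measure (Vec n)).prod Measure.count) = ∑ k, ∫ x, f (x, k) := by
  rw [integral_prod_symm _ (integrable_prod_count hc hi), integral_count]

theorem continuous_jscore_apply (η v : MParam n m) (k : Fin (m + 1)) :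
    Continuous fun x => jscore η x k v :=
  (continuous_jscore η k).clm_apply continuous_const

theorem compIntegrable_jscore_mul_jscore {η : MParam n m} (hη : η ∈ admissible n m)
    (u v : MParam n m) (k : Fin (m + 1)) :
    CompIntegrable η k (fun x => jscore η x k u * jscore η x k v) :=
  (expIntegrable_of_subGauss hη ((SubGauss.jscore η u k).mul (.jscore η v k))
    ((continuous_jscore_apply η u k).mul (continuous_jscore_apply η v k)) k).compIntegrable hη

theorem jointQ_mul_score_eq {η : MParam n m} (hη : η ∈ admissible n m) (u v : MParam n m)
    (x : Vec n) (k : Fin (m + 1)) :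
    jointQ η (x, k) * (fderiv ℝ (fun η' => Real.log (jointQ η' (x, k))) η u *
      fderiv ℝ (fun η' => Real.log (jointQ η' (x, k))) η v) =
    weight η.odds k * (natGauss (η.comp k) x * (jscore η x k u * jscore η x k v)) := by
  rw [(hasFDerivAt_log_jointQ hη x k).fderiv, jointQ]
  ring

theorem integrable_jointQ_mul_score {η : MParam n m} (hη : η ∈ admissible n m)
    (u v : MParam n m) :
    Integrable (fun y => jointQ η y * (fderiv ℝ (fun η' => Real.log (jointQ η' y)) η u *
      fderiv ℝ (fun η' => Real.log (jointQ η' y)) η v))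
      ((volume : Measure (Vec n)).prod Measure.count) := by
  refine integrable_prod_count (fun k => ?_) fun k => ?_ <;>
    simp only [jointQ_mul_score_eq hη]
  · exact continuous_const.mul ((continuous_natGauss (hη k)).mul
      ((continuous_jscore_apply η u k).mul (continuous_jscore_apply η v k)))
  · exact (compIntegrable_jscore_mul_jscore hη u v k).const_mul _

theorem approxFIM_apply {η : MParam n m} (hη : η ∈ admissible n m) (a b : MIndex n m) :
    approxFIM η a b = ∑ k, weight η.odds k * compE η k
      (fun x => jscore η x k (Pi.single a 1) * jscore η x k (Pi.single b 1)) := by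
  rw [approxFIM, fisherInfo, Matrix.of_apply, integral_prod_count]
  · simp only [jointQ_mul_score_eq hη, integral_const_mul, compE]
  · intro k
    simp only [jointQ_mul_score_eq hη]
    exact continuous_const.mul ((continuous_natGauss (hη k)).mul
      ((continuous_jscore_apply η _ k).mul (continuous_jscore_apply η _ k)))
  · intro k
    simp only [jointQ_mul_score_eq hη]
    exact (compIntegrable_jscore_mul_jscore hη _ _ k).const_mul _

theorem clm_apply_eq_sum {ι : Type*} [Fintype ι] [DecidableEq ι] (L : (ι → ℝ) →L[ℝ] ℝ)
    (u : ι → ℝ) : L u = ∑ b, u b * L (Pi.single b 1) := by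
  conv_lhs => rw [pi_eq_sum_univ' u]
  rw [map_sum]
  refine Finset.sum_congr rfl fun b _ => ?_
  rw [← smul_eq_mul, ← map_smul]

theorem approxFIM_mulVec {η : MParam n m} (hη : η ∈ admissible n m) (u : MParam n m)
    (a : MIndex n m) :
    (approxFIM η *ᵥ u) a = ∑ k, weight η.odds k * compE η k
      (fun x => jscore η x k (Pi.single a 1) * jscore η x k u) := by
  have e (k : Fin (m + 1)) : compE η k (fun x => jscore η x k (Pi.single a 1) * jscore η x k u) =
      ∑ b, u b * compE η k
        (fun x => jscore η x k (Pi.single a 1) * jscore η x k (Pi.single b 1)) := by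
    simp only [← compE_const_mul]
    rw [← compE_sum]
    · congr 1
      ext x
      rw [clm_apply_eq_sum (jscore η x k) u, Finset.mul_sum]
      exact Finset.sum_congr rfl fun b _ => by ring
    · intro b _
      refine ((compIntegrable_jscore_mul_jscore hη (Pi.single a 1) (Pi.single b 1) k).const_mul
        (u b)).congr (.of_forall fun x => ?_)
      simp only
      ring
  simp only [Matrix.mulVec, dotProduct, approxFIM_apply hη, e, Finset.sum_mul, Finset.mul_sum]
  rw [Finset.sum_comm]
  exact Finset.sum_congr rfl fun k _ => Finset.sum_congr rfl fun b _ => by ring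

theorem dotProduct_approxFIM_mulVec {η : MParam n m} (hη : η ∈ admissible n m)
    (u : MParam n m) :
    u ⬝ᵥ (approxFIM η *ᵥ u) = ∑ k, weight η.odds k * compE η k
      (fun x => jscore η x k u * jscore η x k u) := by
  have e (k : Fin (m + 1)) : compE η k (fun x => jscore η x k u * jscore η x k u) =
      ∑ b, u b * compE η k (fun x => jscore η x k (Pi.single b 1) * jscore η x k u) := by
    simp only [← compE_const_mul]
    rw [← compE_sum]
    · congr 1
      ext x
      conv_lhs => rw [clm_apply_eq_sum (jscore η x k) u, Finset.sum_mul]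
      refine Finset.sum_congr rfl fun b _ => ?_
      rw [← clm_apply_eq_sum (jscore η x k) u]
      ring
    · intro b _
      refine ((compIntegrable_jscore_mul_jscore hη (Pi.single b 1) u k).const_mul
        (u b)).congr (.of_forall fun x => ?_)
      simp only
      ring
  simp only [dotProduct, approxFIM_mulVec hη, e, Finset.mul_sum]
  rw [Finset.sum_comm]
  exact Finset.sum_congr rfl fun k _ => Finset.sum_congr rfl fun b _ => by ring

theorem eq_zero_of_gam_Gam {θ : GParam n} (h1 : ∀ i, θ.gam i = 0) (h2 : ∀ i j, θ.Gam i j = 0) :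
    θ = 0 := by
  ext a
  rcases a with i | ⟨⟨i, j⟩, hij⟩
  · exact h1 i
  · have := h2 i j
    simp only at hij
    simpa [GParam.Gam, min_eq_left hij, max_eq_right hij] using this

/-- The first derivatives at the origin recover `γ` and the second derivatives recover `Γ`. -/
theorem eq_zero_of_suff_const {θ : GParam n} {c : ℝ} (h : ∀ x : Vec n, suff x θ + c = 0) :
    θ = 0 := by
  have h0 : (fun x : Vec n => suff x θ) = fun _ => -c := by
    ext x; linarith [h x]
  have h1 (i : Fin n) : suffGrad θ i = fun _ => 0 := by
    ext x
    rw [← pd_suff, h0, pd_const]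
  refine eq_zero_of_gam_Gam (fun i => ?_) fun i j => ?_
  · simpa [suffGrad] using congrFun (h1 i) 0
  · have := pd_suffGrad θ i j 0
    rw [h1, pd_const] at this
    linarith

/-- For the reference label, whose log-odds are zero, the hypothesis says that the weighted mean of
the log-odds vanishes; the other labels then give the coordinates of `v`. -/
theorem eq_zero_of_wscore {w v : Fin m → ℝ} (h : ∀ k, wscore w k v = 0) : v = 0 := by
  have h0 := h (Fin.last m)
  ext i
  have hi := h i.castSucc
  simp only [wscore, sub_apply, logOddsL, Fin.lastCases_last, Fin.lastCases_castSucc] at h0 hi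
  simp at h0 hi ⊢
  linarith

theorem eq_zero_of_jscore {η v : MParam n m} (h : ∀ x k, jscore η x k v = 0) : v = 0 := by
  have hcomp (k : Fin (m + 1)) : v.comp k = 0 := by
    refine eq_zero_of_suff_const (c := -(fderiv ℝ logZ (η.comp k) (v.comp k))
      + wscore η.odds k v.odds) fun x => ?_
    have := h x k
    rw [jscore_apply, gscore, sub_apply] at this
    linarith
  have hodds : v.odds = 0 := eq_zero_of_wscore (w := η.odds) fun k => by
    have := h 0 k
    rwa [jscore_apply, hcomp, map_zero, zero_add] at this
  ext a
  rcases a with ⟨a, k⟩ | k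
  · exact congrFun (hcomp k) a
  · exact congrFun hodds k

/-- The quadratic form is a mean of squared scores. If it vanishes, the score vanishes almost
everywhere, hence everywhere by continuity, and identifiability of the parametrization
(`eq_zero_of_jscore`) forces `v = 0`. -/
theorem approxFIM_posDef {η : MParam n m} (hη : η ∈ admissible n m) : (approxFIM η).PosDef := by
  refine Matrix.PosDef.of_dotProduct_mulVec_pos ?_ fun v hv => ?_
  · ext a b
    simp only [Matrix.conjTranspose_apply, star_trivial, approxFIM_apply hη]
    simp only [mul_comm (jscore η _ _ (Pi.single a 1))]
  rw [star_trivial, dotProduct_approxFIM_mulVec hη]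
  have hnn (k : Fin (m + 1)) : 0 ≤ fun x => natGauss (η.comp k) x *
      (jscore η x k v * jscore η x k v) := fun x =>
    mul_nonneg (natGauss_pos (hη k) x).le (mul_self_nonneg _)
  have hcE (k : Fin (m + 1)) : 0 ≤ weight η.odds k * compE η k
      (fun x => jscore η x k v * jscore η x k v) :=
    mul_nonneg (weight_pos _ _).le (integral_nonneg (hnn k))
  refine lt_of_le_of_ne (Finset.sum_nonneg fun k _ => hcE k) fun h0 => hv ?_
  refine eq_zero_of_jscore (η := η) fun x k => ?_
  have h1 := (Finset.sum_eq_zero_iff_of_nonneg fun k _ => hcE k).1 h0.symm k (Finset.mem_univ k)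
  have h2 := (mul_eq_zero.1 h1).resolve_left (weight_pos _ _).ne'
  have h3 := (integral_eq_zero_iff_of_nonneg (hnn k)
    (compIntegrable_jscore_mul_jscore hη v v k)).1 h2
  have hcont : Continuous fun x => natGauss (η.comp k) x * (jscore η x k v * jscore η x k v) :=
    (continuous_natGauss (hη k)).mul
      ((continuous_jscore_apply η v k).mul (continuous_jscore_apply η v k))
  have h4 := congrFun ((hcont.ae_eq_iff_eq volume continuous_zero).1 h3) x
  simpa [(natGauss_pos (hη k) x).ne'] using h4

theorem comp_single_inl (a : GIndex n) (k j : Fin (m + 1)) :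
    MParam.comp (Pi.single (Sum.inl (a, k)) 1 : MParam n m) j
      = if j = k then Pi.single a 1 else 0 := by
  ext b
  by_cases hj : j = k <;> by_cases hb : b = a <;> simp [MParam.comp, hj, hb]

theorem odds_single_inl (a : GIndex n) (k : Fin (m + 1)) :
    MParam.odds (Pi.single (Sum.inl (a, k)) 1 : MParam n m) = 0 := by
  ext b; simp [MParam.odds]

theorem comp_single_inr (i : Fin m) (j : Fin (m + 1)) :
    MParam.comp (Pi.single (Sum.inr i) 1 : MParam n m) j = 0 := by
  ext b; simp [MParam.comp]

theorem odds_single_inr (i : Fin m) :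
    MParam.odds (Pi.single (Sum.inr i) 1 : MParam n m) = Pi.single i 1 := by
  ext b; simp [MParam.odds, Pi.single_apply]

theorem jscore_single_inl (η : MParam n m) (x : Vec n) (j k : Fin (m + 1)) (a : GIndex n) :
    jscore η x j (Pi.single (Sum.inl (a, k)) 1)
      = if j = k then gscore (η.comp j) x (Pi.single a 1) else 0 := by
  rw [jscore_apply, comp_single_inl, odds_single_inl, map_zero, add_zero]
  split_ifs <;> simp

theorem jscore_single_inr (η : MParam n m) (x : Vec n) (j : Fin (m + 1)) (i : Fin m) :
    jscore η x j (Pi.single (Sum.inr i) 1) = wscore η.odds j (Pi.single i 1) := by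
  rw [jscore_apply, comp_single_inr, odds_single_inr, map_zero, zero_add]

theorem fisherInfo_natGauss_apply {η : MParam n m} (hη : η ∈ admissible n m) (k : Fin (m + 1))
    (a b : GIndex n) :
    fisherInfo (volume : Measure (Vec n)) natGauss (η.comp k) a b = compE η k
      (fun x => gscore (η.comp k) x (Pi.single a 1) * gscore (η.comp k) x (Pi.single b 1)) := by
  simp only [fisherInfo, Matrix.of_apply, (hasFDerivAt_log_natGauss (hη k) _).fderiv, compE]

theorem fisherInfo_weight_apply (w : Fin m → ℝ) (a b : Fin m) :
    fisherInfo Measure.count weight w a b =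
      ∑ k, weight w k * (wscore w k (Pi.single a 1) * wscore w k (Pi.single b 1)) := by
  simp only [fisherInfo, Matrix.of_apply, (hasFDerivAt_log_weight w _).fderiv, integral_count]

/-- Scores of different components live on different labels, so their product is zero. A component
score meets a label score, constant in `x`, only through its own mean, which is zero. -/
theorem approxFIM_eq_fromBlocks {η : MParam n m} (hη : η ∈ admissible n m) :
    approxFIM η = Matrix.fromBlocks
      (Matrix.blockDiagonal fun k =>
        weight η.odds k • fisherInfo (volume : Measure (Vec n)) natGauss (η.comp k))
      0 0 (fisherInfo Measure.count weight η.odds) := by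
  have hmix (a : GIndex n) (k j : Fin (m + 1)) (c : ℝ) : compE η j (fun x =>
      c * if j = k then gscore (η.comp j) x (Pi.single a 1) else 0) = 0 := by
    rw [compE_const_mul]
    by_cases hj : j = k
    · simp only [hj, if_true]
      rw [compE_gscore hη, mul_zero]
    · simp only [hj, if_false]
      rw [compE_const hη, mul_zero]
  ext a b
  rw [approxFIM_apply hη]
  rcases a with ⟨a, k⟩ | i <;> rcases b with ⟨b, l⟩ | j
  · rw [Matrix.fromBlocks_apply₁₁, Matrix.blockDiagonal_apply]
    simp only [jscore_single_inl]
    rw [Finset.sum_eq_single k]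
    · by_cases hkl : k = l
      · subst hkl
        simp [fisherInfo_natGauss_apply hη]
      · simp [hkl, compE]
    · intro j _ hj
      simp [hj, compE]
    · simp
  · rw [Matrix.fromBlocks_apply₁₂, Matrix.zero_apply]
    simp only [jscore_single_inl, jscore_single_inr]
    refine Finset.sum_eq_zero fun r _ => ?_
    simp only [mul_comm _ (wscore η.odds r _), hmix, mul_zero]
  · rw [Matrix.fromBlocks_apply₂₁, Matrix.zero_apply]
    simp only [jscore_single_inl, jscore_single_inr, hmix, mul_zero, Finset.sum_const_zero]
  · rw [Matrix.fromBlocks_apply₂₂, fisherInfo_weight_apply]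
    simp only [jscore_single_inr, compE_const hη]

/-! ### The velocity of the flow -/

/-- `V` is twice continuously differentiable, and `V`, `∇V` and `∇²V` have finite expectations
under slightly enlarged components. -/
structure Regular (η : MParam n m) (V : Vec n → ℝ) : Prop where
  contDiff : ContDiff ℝ 2 V
  expIntegrable : ∀ k, ExpIntegrable (suff · (η.comp k)) V
  pd : ∀ k i, ExpIntegrable (suff · (η.comp k)) (pd i V)
  pd_pd : ∀ k i j, ExpIntegrable (suff · (η.comp k)) (GMFlow.pd j (GMFlow.pd i V))

theorem Regular.add {η : MParam n m} {V W : Vec n → ℝ} (hV : Regular η V) (hW : Regular η W) :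
    Regular η (fun x => V x + W x) := by
  have e (i : Fin n) : GMFlow.pd i (fun x => V x + W x) = fun x =>
      GMFlow.pd i V x + GMFlow.pd i W x := by
    ext x
    exact pd_add (hV.contDiff.differentiable (by norm_num) x)
      (hW.contDiff.differentiable (by norm_num) x) i
  have e2 (i j : Fin n) : GMFlow.pd j (GMFlow.pd i (fun x => V x + W x)) = fun x =>
      GMFlow.pd j (GMFlow.pd i V) x + GMFlow.pd j (GMFlow.pd i W) x := by
    ext x
    rw [e]
    exact pd_add ((contDiff_pd hV.contDiff i).differentiable (by norm_num) x)
      ((contDiff_pd hW.contDiff i).differentiable (by norm_num) x) j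
  refine ⟨hV.contDiff.add hW.contDiff, fun k => (hV.expIntegrable k).add (hW.expIntegrable k),
    fun k i => ?_, fun k i j => ?_⟩
  · rw [e]; exact (hV.pd k i).add (hW.pd k i)
  · rw [e2]; exact (hV.pd_pd k i j).add (hW.pd_pd k i j)

theorem pd_neg (V : Vec n → ℝ) (i : Fin n) : pd i (fun x => -V x) = fun x => -pd i V x := by
  ext x; simp [pd, fderiv_fun_neg]

theorem Regular.neg {η : MParam n m} {V : Vec n → ℝ} (hV : Regular η V) :
    Regular η (fun x => -V x) := by
  refine ⟨hV.contDiff.neg, fun k => (hV.expIntegrable k).neg, fun k i => ?_, fun k i j => ?_⟩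
  · rw [pd_neg]; exact (hV.pd k i).neg
  · rw [pd_neg, pd_neg]; exact (hV.pd_pd k i j).neg

theorem regular_log_mixture {η : MParam n m} (hη : η ∈ admissible n m) :
    Regular η (fun x => Real.log (mixture η x)) := by
  have hc := contDiff_log_mixture hη
  exact ⟨hc, fun k => expIntegrable_of_subGauss hη (.log_mixture hη) hc.continuous k,
    fun k i => expIntegrable_of_subGauss hη (.pd_log_mixture hη i) (contDiff_pd hc i).continuous k,
    fun k i j => expIntegrable_of_subGauss hη (.pd_pd_log_mixture hη i j)
      (continuous_pd (contDiff_pd hc i) j) k⟩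

theorem regular_suff {η : MParam n m} (hη : η ∈ admissible n m) (θ : GParam n) (c : ℝ) :
    Regular η (fun x => suff x θ + c) := by
  have e (i : Fin n) : pd i (fun x : Vec n => suff x θ + c) = suffGrad θ i := by
    ext x
    rw [pd_add (differentiable_suff θ x) (by fun_prop), pd_const, add_zero, pd_suff]
  have e2 (i j : Fin n) : pd j (pd i (fun x : Vec n => suff x θ + c)) = fun _ =>
      2 * θ.Gam i j := by
    ext x
    rw [e, pd_suffGrad]
  refine ⟨(contDiff_suff θ).add contDiff_const, fun k => expIntegrable_of_subGauss hη
    ((SubGauss.suff θ).add (.const c)) ((continuous_suff_apply θ).add continuous_const) k,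
    fun k i => ?_, fun k i j => ?_⟩
  · rw [e]
    exact expIntegrable_of_subGauss hη (.suffGrad θ i) (contDiff_suffGrad θ i).continuous k
  · rw [e2]
    exact expIntegrable_of_subGauss hη (.const _) continuous_const k

/-- The right-hand side of the component-wise equations. -/
def velocity (V : Vec n → ℝ) (η : MParam n m) : MParam n m
  | Sum.inl (Sum.inl i, k) => -compE η k (fun x =>
      ((1 / 2 : ℝ) • (hessian V x *ᵥ ((η.comp k).Gam⁻¹ *ᵥ (η.comp k).gam))) i + gradient V x i)
  | Sum.inl (Sum.inr p, k) => -(1 / 2 : ℝ) * compE η k (fun x => hessian V x p.1.1 p.1.2)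
  | Sum.inr k => compE η (Fin.last m) V - compE η k.castSucc V

/-- Only entries on and above the diagonal are stored; the others agree by symmetry of the Hessian,
where `C²` regularity enters. -/
theorem velocity_Gam {V : Vec n → ℝ} (hV : ContDiff ℝ 2 V) (η : MParam n m) (k : Fin (m + 1))
    (i j : Fin n) : ((velocity V η).comp k).Gam i j
      = -(1 / 2 : ℝ) * compE η k (fun x => hessian V x i j) := by
  rcases le_total i j with h | h
  · simp [GParam.Gam, MParam.comp, velocity, h]
  · simp [GParam.Gam, MParam.comp, velocity, h, hessian_apply hV, pd_comm hV _ i j]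

theorem velocity_logOdds (V : Vec n → ℝ) (η : MParam n m) (k : Fin (m + 1)) :
    logOdds (velocity V η).odds k = compE η (Fin.last m) V - compE η k V := by
  refine Fin.lastCases ?_ (fun i => ?_) k
  · simp [logOdds]
  · simp [logOdds, MParam.odds, velocity]

theorem velocity_gam {η : MParam n m} (hη : η ∈ admissible n m) {V : Vec n → ℝ}
    (hV : Regular η V) (k : Fin (m + 1)) (i : Fin n) :
    ((velocity V η).comp k).gam i = -(∑ j, (1 / 2 : ℝ) *
      ((η.comp k).Gam⁻¹ *ᵥ (η.comp k).gam) j * compE η k (pd j (pd i V)) + compE η k (pd i V)) := by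
  set y := (η.comp k).Gam⁻¹ *ᵥ (η.comp k).gam
  have e (x : Vec n) : ((1 / 2 : ℝ) • (hessian V x *ᵥ y)) i + gradient V x i =
      (∑ j, (1 / 2 : ℝ) * y j * pd j (pd i V) x) + pd i V x := by
    simp only [Pi.smul_apply, Matrix.mulVec, dotProduct, hessian_apply hV.contDiff, gradient_apply,
      smul_eq_mul, Finset.mul_sum]
    congr 1
    exact Finset.sum_congr rfl fun j _ => by ring
  have hi (j : Fin n) : CompIntegrable η k fun x => (1 / 2 : ℝ) * y j * pd j (pd i V) x :=
    ((hV.pd_pd k i j).const_mul _).compIntegrable hη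
  have hs : CompIntegrable η k fun x => ∑ j, (1 / 2 : ℝ) * y j * pd j (pd i V) x := by
    simp only [CompIntegrable, Finset.mul_sum]
    exact integrable_finsetSum _ fun j _ => hi j
  change -compE η k _ = _
  simp only [y] at e hi hs ⊢
  simp only [e]
  rw [compE_add hs ((hV.pd k i).compIntegrable hη), compE_sum _ fun j _ => hi j]
  simp only [compE_const_mul]

/-- Stein's identity for the constant function one. -/
theorem compE_suffGrad_self {η : MParam n m} (hη : η ∈ admissible n m) (k : Fin (m + 1))
    (i : Fin n) : compE η k (suffGrad (η.comp k) i) = 0 := by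
  have h := integral_exp_suff_mul_pd (θ := η.comp k) (f := fun _ : Vec n => 1)
    (differentiable_const _) (expIntegrable_one (hη k)) i
    (by simpa [funext (pd_const (n := n) 1 i)] using (expIntegrable_one (hη k)).const_mul 0)
  simp only [pd_const, mul_zero, mul_one, integral_zero] at h
  rw [compE, integral_natGauss_mul (hη k)]
  rw [neg_eq_zero.1 h.symm, mul_zero]

theorem compIntegrable_of_subGauss {η : MParam n m} (hη : η ∈ admissible n m) {f : Vec n → ℝ}
    (hf : SubGauss f) (hc : Continuous f) (k : Fin (m + 1)) : CompIntegrable η k f :=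
  (expIntegrable_of_subGauss hη hf hc k).compIntegrable hη

/-- The mean comes from averaging `coord_eq_sum_suffGrad`; it explains the vector `Γ⁻¹ γ` in the
equation for `γ`. -/
theorem compE_coord {η : MParam n m} (hη : η ∈ admissible n m) (k : Fin (m + 1)) (i : Fin n) :
    compE η k (fun x => x i) = -(1 / 2) * ((η.comp k).Gam⁻¹ *ᵥ (η.comp k).gam) i := by
  have hg (j : Fin n) : Continuous (suffGrad (η.comp k) j) := (contDiff_suffGrad _ j).continuous
  have e : (fun x : Vec n => x i) = fun x => ∑ j, (1 / 2 * (η.comp k).Gam⁻¹ i j) *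
      (suffGrad (η.comp k) j x + -(η.comp k).gam j) := by
    ext x
    simpa only [← sub_eq_add_neg] using coord_eq_sum_suffGrad (gAdmissible_isUnit_det (hη k)) x i
  rw [e, compE_sum _ fun j _ => compIntegrable_of_subGauss hη ((SubGauss.const _).mul
    ((SubGauss.suffGrad _ j).add (.const _))) (continuous_const.mul ((hg j).add continuous_const)) k]
  simp only [compE_const_mul]
  have e2 (j : Fin n) : compE η k (fun x => suffGrad (η.comp k) j x + -(η.comp k).gam j) =
      -(η.comp k).gam j := by
    rw [compE_add (compIntegrable_of_subGauss hη (.suffGrad _ j) (hg j) k)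
      (compIntegrable_of_subGauss hη (.const _) continuous_const k), compE_const hη]
    have := compE_suffGrad_self hη k j
    linarith
  simp only [e2, Matrix.mulVec, dotProduct, Finset.mul_sum]
  exact Finset.sum_congr rfl fun j _ => by ring

theorem compE_suffGrad {η : MParam n m} (hη : η ∈ admissible n m) (k : Fin (m + 1))
    (v : GParam n) (i : Fin n) : compE η k (suffGrad v i) =
      v.gam i - ∑ j, v.Gam i j * ((η.comp k).Gam⁻¹ *ᵥ (η.comp k).gam) j := by
  have hi (j : Fin n) : CompIntegrable η k fun x => v.Gam i j * x j :=
    compIntegrable_of_subGauss hη ((SubGauss.const _).mul (.coord j)) (by fun_prop) k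
  have e : suffGrad v i = fun x => v.gam i + 2 * ∑ j, v.Gam i j * x j := rfl
  rw [e, compE_add (compIntegrable_of_subGauss hη (.const _) continuous_const k)
    (compIntegrable_of_subGauss hη ((SubGauss.const 2).mul (.sum _ fun j _ =>
      (SubGauss.const _).mul (.coord j))) (by fun_prop) k), compE_const hη, compE_const_mul,
    compE_sum _ fun j _ => hi j]
  simp only [compE_const_mul, compE_coord hη]
  rw [sub_eq_add_neg, Finset.mul_sum, ← Finset.sum_neg_distrib]
  congr 1
  exact Finset.sum_congr rfl fun j _ => by ring

/-- Up to a constant common to all components, the score in the direction of the velocity is the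
projection of `-V` onto the polynomials of degree at most two. -/
theorem compE_jscore_mul_eq_zero {η : MParam n m} (hη : η ∈ admissible n m) {V : Vec n → ℝ}
    (hV : Regular η V) (v : MParam n m) (k : Fin (m + 1)) :
    compE η k (fun x => jscore η x k v * (jscore η x k (velocity V η) + V x +
      -(compE η (Fin.last m) V - ∑ j, weight η.odds j * logOddsL j (velocity V η).odds))) = 0 := by
  set u := velocity V η with hu
  set c := -(compE η (Fin.last m) V - ∑ j, weight η.odds j * logOddsL j u.odds) with hc
  set b := -(fderiv ℝ logZ (η.comp k) (u.comp k)) + wscore η.odds k u.odds + c with hb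
  have hscore (w : MParam n m) (x : Vec n) : jscore η x k w = suff x (w.comp k) +
      (-(fderiv ℝ logZ (η.comp k) (w.comp k)) + wscore η.odds k w.odds) := by
    rw [jscore_apply, gscore, sub_apply]; ring
  -- Collecting everything constant in `x` into `b`, the function to be tested is `V` plus a
  -- quadratic polynomial.
  have hW : (fun x => jscore η x k u + V x + c) = fun x => (suff x (u.comp k) + b) + V x := by
    ext x; rw [hscore, hb]; ring
  have hreg : Regular η fun x => (suff x (u.comp k) + b) + V x := (regular_suff hη _ b).add hV
  have hdV := hV.contDiff.differentiable (by norm_num)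
  have hpd (i : Fin n) : pd i (fun x => (suff x (u.comp k) + b) + V x) =
      fun x => suffGrad (u.comp k) i x + pd i V x := by
    ext x
    rw [pd_add ((differentiable_suff _ x).add_const b) (hdV x),
      pd_add (differentiable_suff _ x) (by fun_prop), pd_const, pd_suff, add_zero]
  have hpd2 (i j : Fin n) : pd j (pd i (fun x => (suff x (u.comp k) + b) + V x)) =
      fun x => 2 * (u.comp k).Gam i j + pd j (pd i V) x := by
    ext x
    rw [hpd, pd_add ((contDiff_suffGrad _ i).differentiable (by norm_num) x)
      ((contDiff_pd hV.contDiff i).differentiable (by norm_num) x), pd_suffGrad]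
  have hGam (i j : Fin n) : (u.comp k).Gam i j = -(1 / 2) * compE η k (pd j (pd i V)) := by
    rw [hu, velocity_Gam hV.contDiff]
    simp only [hessian_apply hV.contDiff]
  have zero_of_compE {f : Vec n → ℝ} (h : compE η k f = 0) :
      ∫ x, Real.exp (suff x (η.comp k)) * f x = 0 := by
    rw [compE, integral_natGauss_mul (hη k)] at h
    exact (mul_eq_zero.1 h).resolve_left (Real.exp_ne_zero _)
  have key := integral_exp_suff_mul_quadratic_eq_zero (gAdmissible_isUnit_det (hη k)) hreg.contDiff
    (hreg.expIntegrable k) (hreg.pd k) (hreg.pd_pd k) (zero_of_compE ?_)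
    (fun i => zero_of_compE ?_) (fun i j => zero_of_compE ?_) (v.comp k)
    (-(fderiv ℝ logZ (η.comp k) (v.comp k)) + wscore η.odds k v.odds)
  · rw [compE, integral_natGauss_mul (hη k)]
    simp only [hscore v]
    have e (x : Vec n) : jscore η x k u + V x + c = (suff x (u.comp k) + b) + V x := congrFun hW x
    simp only [e]
    rw [key, mul_zero]
  -- Mean zero: the joint score has mean `wscore`, and the log-odds equation makes `wscore` plus the
  -- mean of `V` equal to `-c` for every label.
  · rw [← hW, compE_add (compIntegrable_of_subGauss hη (.jscore η u k)
      (continuous_jscore_apply η u k) k |>.add ((hV.expIntegrable k).compIntegrable hη) |>.congr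
        (.of_forall fun x => by simp [mul_add]))
      (compIntegrable_of_subGauss hη (.const c) continuous_const k), compE_const hη,
      compE_add (compIntegrable_of_subGauss hη (.jscore η u k) (continuous_jscore_apply η u k) k)
      ((hV.expIntegrable k).compIntegrable hη), compE_jscore hη, hc, wscore, sub_apply,
      ← logOdds_eq, hu, velocity_logOdds]
    simp only [sum_apply, smul_apply, smul_eq_mul]
    ring
  -- Mean gradient zero: the equation for `γ`, whose Hessian term cancels the contribution of the
  -- direction of `Γ` at the mean.
  · rw [hpd, compE_add (compIntegrable_of_subGauss hη (.suffGrad _ i)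
      (contDiff_suffGrad _ i).continuous k) ((hV.pd k i).compIntegrable hη), compE_suffGrad hη]
    simp only [hGam]
    rw [hu, velocity_gam hη hV]
    have e : ∑ j, -(1 / 2) * compE η k (pd j (pd i V)) *
        ((η.comp k).Gam⁻¹ *ᵥ (η.comp k).gam) j = -∑ j, (1 / 2 : ℝ) *
        ((η.comp k).Gam⁻¹ *ᵥ (η.comp k).gam) j * compE η k (pd j (pd i V)) := by
      rw [← Finset.sum_neg_distrib]
      exact Finset.sum_congr rfl fun j _ => by ring
    rw [e]
    ring
  -- Mean Hessian zero: the equation for `Γ`.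
  · rw [hpd2, compE_add (compIntegrable_of_subGauss hη (.const _) continuous_const k)
      ((hV.pd_pd k i j).compIntegrable hη), compE_const hη, hGam]
    ring

/-- Orthogonality holds in each component only after adding `c`. As `c` is the same for all labels,
its total contribution is a multiple of the mean label score, which is zero. -/
theorem approxFIM_mulVec_velocity {η : MParam n m} (hη : η ∈ admissible n m) {V : Vec n → ℝ}
    (hV : Regular η V) (a : MIndex n m) :
    (approxFIM η *ᵥ velocity V η) a = -∑ k, weight η.odds k *
      compE η k (fun x => jscore η x k (Pi.single a 1) * V x) := by
  rw [approxFIM_mulVec hη, eq_neg_iff_add_eq_zero, ← Finset.sum_add_distrib]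
  set u := velocity V η
  set v : MParam n m := Pi.single a 1
  set c := -(compE η (Fin.last m) V - ∑ j, weight η.odds j * logOddsL j u.odds) with hc
  have h (k : Fin (m + 1)) : compE η k (fun x => jscore η x k v * jscore η x k u)
      + compE η k (fun x => jscore η x k v * V x) = -c * wscore η.odds k v.odds := by
    have h1 := compIntegrable_jscore_mul_jscore hη v u k
    have h2 : CompIntegrable η k (fun x => jscore η x k v * V x) :=
      ((hV.expIntegrable k).subGauss_mul (.jscore η v k)
        (continuous_jscore_apply η v k)).compIntegrable hη
    have h3 : CompIntegrable η k (fun x => c * jscore η x k v) :=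
      compIntegrable_of_subGauss hη ((SubGauss.const c).mul (.jscore η v k))
        (continuous_const.mul (continuous_jscore_apply η v k)) k
    have h12 : CompIntegrable η k
        (fun x => jscore η x k v * jscore η x k u + jscore η x k v * V x) :=
      (h1.add h2).congr (.of_forall fun x => by simp [mul_add])
    have key := compE_jscore_mul_eq_zero hη hV v k
    have e : (fun x => jscore η x k v * (jscore η x k u + V x + c)) = fun x =>
        (jscore η x k v * jscore η x k u + jscore η x k v * V x) + c * jscore η x k v := by
      ext x; ring
    rw [e, compE_add h12 h3, compE_add h1 h2, compE_const_mul, compE_jscore hη] at key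
    linarith
  have e (k : Fin (m + 1)) : weight η.odds k * compE η k (fun x => jscore η x k v * jscore η x k u)
      + weight η.odds k * compE η k (fun x => jscore η x k v * V x) =
      -c * (weight η.odds k * wscore η.odds k v.odds) := by
    rw [← mul_add, h]; ring
  rw [Finset.sum_congr rfl fun k _ => e k, ← Finset.mul_sum, sum_weight_mul_wscore, mul_zero]

/-! ### The Bayesian model -/

/-- All components are shifted simultaneously and the log-odds are left alone, so one nearby
parameter gives every component its reserve. -/
theorem exists_shift_mem {Θ : Set (MParam n m)} (hΘ : IsOpen Θ) {η : MParam n m} (hη : η ∈ Θ) :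
    ∃ ε > (0 : ℝ), ∃ η' ∈ Θ, ∀ k, η'.comp k = η.comp k + ε • idShift n := by
  let s : MParam n m := Sum.elim (fun p => idShift n p.1) 0
  have hc : Filter.Tendsto (fun ε : ℝ => η + ε • s) (nhdsWithin 0 (Set.Ioi 0)) (nhds η) := by
    have : Continuous (fun ε : ℝ => η + ε • s) := by fun_prop
    simpa using (this.tendsto 0).mono_left nhdsWithin_le_nhds
  obtain ⟨ε, h, hε⟩ := ((hc.eventually (hΘ.mem_nhds hη)).and self_mem_nhdsWithin).exists
  exact ⟨ε, hε, _, h, fun k => rfl⟩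

theorem regular_of_compIntegrable {Θ : Set (MParam n m)} (hΘ : IsOpen Θ)
    (hadm : Θ ⊆ admissible n m) {f : Vec n → ℝ} (hf : ContDiff ℝ 2 f)
    (h : ∀ η ∈ Θ, ∀ k, CompIntegrable η k f ∧ (∀ i, CompIntegrable η k fun x => gradient f x i) ∧
      ∀ i j, CompIntegrable η k fun x => hessian f x i j) {η : MParam n m} (hη : η ∈ Θ) :
    Regular η f := by
  obtain ⟨ε, hε, η', hη', hshift⟩ := exists_shift_mem hΘ hη
  have key {k : Fin (m + 1)} {g : Vec n → ℝ} (hg : CompIntegrable η' k g) :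
      ExpIntegrable (suff · (η.comp k)) g := by
    have ha := hadm hη' k
    rw [CompIntegrable, hshift] at hg
    rw [hshift] at ha
    exact expIntegrable_of_shift hε ha hg
  refine ⟨hf, fun k => key (h η' hη' k).1, fun k i => key ?_, fun k i j => key ?_⟩
  · exact ((h η' hη' k).2.1 i).congr fun x => gradient_apply f x i
  · exact ((h η' hη' k).2.2 i j).congr fun x => hessian_apply hf x i j

theorem integral_pos_of_pos {p : Vec n → ℝ} (hp : ∀ x, 0 < p x)
    (hi : Integrable p) : 0 < ∫ x, p x := by
  rw [integral_pos_iff_support_of_nonneg (fun x => (hp x).le) hi]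
  have : Function.support p = Set.univ := by ext x; simp [(hp x).ne']
  rw [this]
  exact isOpen_univ.measure_pos volume Set.univ_nonempty

section Model

variable {prior : Vec n → ℝ} {lik : Vec d → Vec n → ℝ} {z : Vec d}

theorem regular_kernelV {η : MParam n m} (hη : η ∈ admissible n m)
    (hreg : Regular η fun x => Real.log (jointP prior lik z x)) :
    Regular η (kernelV prior lik z η) := by
  have e : kernelV prior lik z η = fun x =>
      Real.log (mixture η x) + -Real.log (jointP prior lik z x) := by
    ext x; rw [kernelV, sub_eq_add_neg]
  rw [e]
  exact (regular_log_mixture hη).add hreg.neg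

theorem klIntegrand_eq (hp : ∀ x, 0 < jointP prior lik z x)
    (hint : Integrable (jointP prior lik z)) {η : MParam n m} (hη : η ∈ admissible n m)
    (x : Vec n) : klIntegrand (mixture η) (posterior prior lik z) x = mixture η x *
      (Real.log (mixture η x) + (-Real.log (jointP prior lik z x)
        + Real.log (∫ y, jointP prior lik z y))) := by
  have hZ := integral_pos_of_pos hp hint
  rw [klIntegrand, posterior, Real.log_div (mixture_pos hη x).ne' (div_pos (hp x) hZ).ne',
    Real.log_div (hp x).ne' hZ.ne']
  ring

/-- Replacing the posterior by the joint density adds the log-evidence `c` to the integrand's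
logarithm. In the derivative it multiplies the mean label score and disappears. -/
theorem hasFDerivAt_objective (hp : ∀ x, 0 < jointP prior lik z x)
    (hint : Integrable (jointP prior lik z)) {η : MParam n m} (hη : η ∈ admissible n m)
    (hreg : Regular η fun x => Real.log (jointP prior lik z x)) :
    Integrable (klIntegrand (mixture η) (posterior prior lik z)) ∧
    DifferentiableAt ℝ (objective prior lik z) η ∧
    ∀ v, fderiv ℝ (objective prior lik z) η v = ∑ k, weight η.odds k *
      compE η k (fun x => jscore η x k v * kernelV prior lik z η x) := by
  set c := Real.log (∫ y, jointP prior lik z y)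
  set g : Vec n → ℝ := fun x => -Real.log (jointP prior lik z x) + c with hg
  have hgc : Continuous g := hreg.contDiff.continuous.neg.add continuous_const
  have hgi (k : Fin (m + 1)) : ExpIntegrable (suff · (η.comp k)) g :=
    (hreg.expIntegrable k).neg.add (expIntegrable_of_subGauss hη (.const c) continuous_const k)
  obtain ⟨h1, -, h3⟩ := hasFDerivAt_integral_mixture_mul_log hη hgc hgi
  have hobj : HasFDerivAt (objective (m := m) prior lik z) (∫ x, entropyDeriv g η x) η := by
    refine h3.congr_of_eventuallyEq ?_
    filter_upwards [isOpen_admissible.mem_nhds hη] with η' hη'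
    simp only [objective, kl, klIntegrand_eq hp hint hη', hg, c]
  refine ⟨h1.congr (.of_forall fun x => (klIntegrand_eq hp hint hη x).symm),
    hobj.differentiableAt, fun v => ?_⟩
  rw [hobj.fderiv, integral_entropyDeriv hη hgc hgi]
  have hV := regular_kernelV hη hreg
  have e (k : Fin (m + 1)) : compE η k (fun x => jscore η x k v * (Real.log (mixture η x) + g x)) =
      compE η k (fun x => jscore η x k v * kernelV prior lik z η x)
        + c * wscore η.odds k v.odds := by
    rw [← compE_jscore hη, ← compE_const_mul, ← compE_add
      (((hV.expIntegrable k).subGauss_mul (.jscore η v k)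
        (continuous_jscore_apply η v k)).compIntegrable hη)
      (compIntegrable_of_subGauss hη ((SubGauss.const c).mul (.jscore η v k))
        (continuous_const.mul (continuous_jscore_apply η v k)) k)]
    congr 1
    ext x
    simp only [hg, kernelV]
    ring
  have e2 (k : Fin (m + 1)) : weight η.odds k *
      compE η k (fun x => jscore η x k v * (Real.log (mixture η x) + g x)) =
      weight η.odds k * compE η k (fun x => jscore η x k v * kernelV prior lik z η x)
        + c * (weight η.odds k * wscore η.odds k v.odds) := by
    rw [e]; ring
  rw [Finset.sum_congr rfl fun k _ => e2 k, Finset.sum_add_distrib, ← Finset.mul_sum,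
    sum_weight_mul_wscore, mul_zero, add_zero]

theorem flowField_eq_velocity (hp : ∀ x, 0 < jointP prior lik z x)
    (hint : Integrable (jointP prior lik z)) {η : MParam n m} (hη : η ∈ admissible n m)
    (hreg : Regular η fun x => Real.log (jointP prior lik z x)) :
    flowField prior lik z η = velocity (kernelV prior lik z η) η := by
  have hV := regular_kernelV hη hreg
  have h : partials (objective prior lik z) η
      = -(approxFIM η *ᵥ velocity (kernelV prior lik z η) η) := by
    ext a
    rw [Pi.neg_apply, approxFIM_mulVec_velocity hη hV, neg_neg, partials]
    exact (hasFDerivAt_objective hp hint hη hreg).2.2 _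
  rw [flowField, h, Matrix.mulVec_neg, neg_neg, Matrix.mulVec_mulVec,
    Matrix.nonsing_inv_mul _ (approxFIM_posDef hη).det_pos.ne'.isUnit, Matrix.one_mulVec]

/-- The component equations repeat the coordinate equations: those below the diagonal duplicate
those above, and the one for the reference log-odds reads `0 = 0`. -/
theorem hasDerivWithinAt_velocity_iff {c : ℝ → MParam n m} {I : Set ℝ} {t : ℝ}
    (hV : ContDiff ℝ 2 (kernelV prior lik z (c t))) :
    HasDerivWithinAt c (velocity (kernelV prior lik z (c t)) (c t)) I t ↔
      ∀ k, ComponentODE prior lik z c I t k := by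
  rw [hasDerivWithinAt_pi]
  constructor
  · intro h k
    refine ⟨fun i => h (Sum.inl (Sum.inl i, k)), fun i j => ?_, ?_⟩
    · rw [← velocity_Gam hV]
      exact h (Sum.inl (Sum.inr ⟨(min i j, max i j), min_le_max⟩, k))
    · rw [← velocity_logOdds]
      refine Fin.lastCases ?_ (fun i => ?_) k
      · simp only [logOdds, Fin.lastCases_last]
        exact hasDerivWithinAt_const _ _ _
      · simp only [logOdds, Fin.lastCases_castSucc]
        exact h (Sum.inr i)
  · intro h a
    rcases a with ⟨i | ⟨⟨i, j⟩, hij⟩, k⟩ | i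
    · exact (h k).1 i
    · have := (h k).2.1 i j
      simp only at hij
      simpa only [GParam.Gam, Matrix.of_apply, min_eq_left hij, max_eq_right hij] using! this
    · have := (h i.castSucc).2.2
      simpa only [logOdds, Fin.lastCases_castSucc] using! this

end Model

end GMFlow

end

/-! ### Assembly of the three claims -/

open GMFlow in
theorem mainTheorem4 {n m d : ℕ}
    (prior : Vec n → ℝ) (lik : Vec d → Vec n → ℝ) (z : Vec d)
    (hprior : ∀ x, 0 < prior x) (hlik : ∀ x, 0 < lik z x)
    (hsmooth : ContDiff ℝ 2 (jointP prior lik z))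
    (hint : Integrable (jointP prior lik z) volume)
    (Θ : Set (MParam n m)) (hopen : IsOpen Θ) (hadm : Θ ⊆ admissible n m)
    -- `log p(x, z)` and its first two derivatives have finite expectations under the components
    (hlog : ∀ η ∈ Θ, ∀ k,
      CompIntegrable η k (fun x => Real.log (jointP prior lik z x)) ∧
      (∀ i, CompIntegrable η k
        (fun x => gradient (fun y => Real.log (jointP prior lik z y)) x i)) ∧
      (∀ i j, CompIntegrable η k
        (fun x => hessian (fun y => Real.log (jointP prior lik z y)) x i j))) :
    -- the objects entering the flow and its component-wise form are well defined
    (∀ η ∈ Θ,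
      (∀ a b, Integrable (fun y => jointQ η y *
        (fderiv ℝ (fun η' => Real.log (jointQ η' y)) η (Pi.single a 1) *
          fderiv ℝ (fun η' => Real.log (jointQ η' y)) η (Pi.single b 1)))
        ((volume : Measure (Vec n)).prod Measure.count)) ∧
      (approxFIM η).PosDef ∧
      Integrable (klIntegrand (mixture η) (posterior prior lik z)) volume ∧
      DifferentiableAt ℝ (objective prior lik z) η ∧
      ContDiff ℝ 2 (kernelV prior lik z η) ∧
      (∀ k, CompIntegrable η k (kernelV prior lik z η) ∧
        (∀ i, CompIntegrable η k (fun x => gradient (kernelV prior lik z η) x i)) ∧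
        (∀ i j, CompIntegrable η k (fun x => hessian (kernelV prior lik z η) x i j)))) ∧
    -- the approximated Fisher information matrix is block diagonal
    (∀ η ∈ Θ, approxFIM η = Matrix.fromBlocks
      (Matrix.blockDiagonal fun k =>
        weight η.odds k • fisherInfo (volume : Measure (Vec n)) natGauss (η.comp k))
      0 0 (fisherInfo Measure.count weight η.odds)) ∧
    -- the flow equation is equivalent to the component-wise equations
    (∀ (c : ℝ → MParam n m) (I : Set ℝ) (t : ℝ), t ∈ I → c t ∈ Θ →
      (HasDerivWithinAt c (flowField prior lik z (c t)) I t ↔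
        ∀ k, ComponentODE prior lik z c I t k)) := by
  have hp : ∀ x, 0 < jointP prior lik z x := fun x => mul_pos (hlik x) (hprior x)
  have hreg {η : MParam n m} (hη : η ∈ Θ) :
      Regular η fun x => Real.log (jointP prior lik z x) :=
    regular_of_compIntegrable hopen hadm (hsmooth.log fun x => (hp x).ne') hlog hη
  have hV {η : MParam n m} (hη : η ∈ Θ) : Regular η (kernelV prior lik z η) :=
    regular_kernelV (hadm hη) (hreg hη)
  refine ⟨fun η hη => ?_, fun η hη => approxFIM_eq_fromBlocks (hadm hη), fun c I t _ hct => ?_⟩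
  · have hobj := hasFDerivAt_objective hp hint (hadm hη) (hreg hη)
    have hc := (hV hη).contDiff
    refine ⟨fun a b => integrable_jointQ_mul_score (hadm hη) _ _, approxFIM_posDef (hadm hη),
      hobj.1, hobj.2.1, hc, fun k => ⟨((hV hη).expIntegrable k).compIntegrable (hadm hη),
        fun i => ?_, fun i j => ?_⟩⟩
    · exact (((hV hη).pd k i).compIntegrable (hadm hη)).congr fun x => (gradient_apply _ x i).symm
    · exact (((hV hη).pd_pd k i j).compIntegrable (hadm hη)).congr
        fun x => (hessian_apply hc x i j).symm
  · rw [flowField_eq_velocity hp hint (hadm hct) (hreg hct)]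
    exact hasDerivWithinAt_velocity_iff (hV hct).contDiff
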